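/- **Setting.** Let $G=(V,E)$ be a finite, simple, connected graph with $n\ge 1$ vertices and clique number $\omega(G)$, whose vertices are labeled (hence linearly ordered) by a bijection $V\to\{0,\dots,n-1\}$. A set $C\subseteq V$ is *m-convex* if it contains every vertex of every induced path of $G$ between two vertices of $C$; $\mathfrak m(S)$ is the smallest m-convex set containing $S$; an *m-halfspace* is an m-convex set with m-convex complement, and $\mathcal H_{\mathfrak m}(G)$ is the set of all m-halfspaces (including $\varnothing$ and $V$). For $A,B\subseteq V$, let $\mathrm{Imp}_B(A)$ be the set of all $a\in A$ for which there are $b\in B$ and a path $P$ from $a$ to $b$ with $P\cap A=\{a\}$ and $P\cap B=\{b\}$. A *sample* is a sign vector $X\in\{-1,0,1\}^V$, with $X^{+}=\{v:X_v=1\}$, $X^-=\{v:X_v=-1\}$ and support $\underline X=X^+\cup X^-$. Write $X\preceq Y$ if $X_v\in\{0,Y_v\}$ for all $v$, and identify $H\subseteq V$ with the vector that is $+1$ on $H$ and $-1$ off $H$. For $\mathcal C\subseteq 2^V$, a sample $X$ is *realizable* if $X\preceq H$ for some $H\in\mathcal C$. A *labeled sample compression scheme* (LSCS) of size $k$ for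 $\mathcal C$ is a pair $\alpha:\{-1,0,1\}^V\to\{-1,0,1\}^V$, $\beta:\{-1,0,1\}^V\to\{-1,1\}^V$ with $\alpha(X)\preceq X\preceq\beta(\alpha(X))$ and $|\underline{\alpha(X)}|\le k$ for every realizable $X$. It is *proper* if $\beta(\alpha(X))\in\mathcal C$ for every realizable $X$, and *stable* if $\beta(\alpha(X'))=\beta(\alpha(X))$ whenever $X$ is realizable and $\alpha(X)\preceq X'\preceq X$. **The compressor.** Let $X$ be realizable for $\mathcal H_{\mathfrak m}(G)$, and put $A=\mathfrak m(X^+)$, $B=\mathfrak m(X^-)$. If $X^+$ and $X^-$ are both nonempty, $\alpha(X)^+$ is the union, over all $a\in\mathrm{Imp}_B(A)$, of the lexicographically first pair $x,x'\in X^+$ (possibly $x=x'$) with $a\in\mathfrak m(\{x,x'\})$, and $\alpha(X)^-\subseteq X^-$ is defined in the same way from $\mathrm{Imp}_A(B)$ and $X^-$. If exactly one of $X^+,X^-$ is nonempty, $\alpha(X)$ keeps only the first vertex of $\underline X$, with its label; and $\alpha(0)=0$. **The reconstructor.** Call $\beta$ a *reconstructor* if for every realizable $X$ and $Y=\alpha(X)$,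 with $A'=\mathfrak m(Y^+)$ and $B'=\mathfrak m(Y^-)$, the set $\beta(Y)=H$ is an m-halfspace with $\mathrm{Imp}_{B'}(A')\subseteq H$ and $\mathrm{Imp}_{A'}(B')\subseteq V\setminus H$, where moreover $H=V$ if $Y^-=\varnothing\neq Y^+$ and $H=\varnothing$ if $Y^+=\varnothing\ne Y^-$. **Theorem.** For every such $G$ and every labeling of its vertices: 1. for every reconstructor $\beta$, the pair $(\alpha,\beta)$ is a proper and stable LSCS of size $4\omega(G)$ for $\mathcal H_{\mathfrak m}(G)$; 2. there is a reconstructor $\beta$ such that compression and reconstruction both run in time $\mathrm{poly}(n)$: there are two programs and one polynomial $p$, independent of $G$, of the labeling and of the sample, such that for every realizable $X$ the first program computes $\alpha(X)$ from $(G,X)$ and the second computes $\beta(\alpha(X))$ from $(G,\alpha(X))$, each in at most $p(n)$ steps. Here a program is one for a random access machine with registers and arrays of natural numbers, addition and truncated subtraction, tests and loops, in which each operation and each memory access costs one step; $G$ is given by its labeled adjacency matrix. In particular, $\mathcal H_{\mathfrak m}(G)$ admits a proper stable LSCS of size $4\omega(G)$ whose compressor and reconstructor run in polynomial time. -/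

import Mathlib

universe u

/-! ### Monophonic convexity -/

namespace Monophonic

variable {V : Type u}

/-- An induced path: a path such that every edge of `G` between two of its vertices is one of
its own edges. -/
def IsInducedPath (G : SimpleGraph V) {u v : V} (p : G.Walk u v) : Prop :=
  p.IsPath ∧ ∀ x ∈ p.support, ∀ y ∈ p.support, G.Adj x y → s(x, y) ∈ p.edges

/-- The monophonic interval: all vertices on induced `(u, v)`-paths. -/
def interval (G : SimpleGraph V) (u v : V) : Set V :=
  {w | ∃ p : G.Walk u v, IsInducedPath G p ∧ w ∈ p.support}

/-- Monophonically convex sets. -/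
def Convex (G : SimpleGraph V) (C : Set V) : Prop :=
  ∀ u ∈ C, ∀ v ∈ C, interval G u v ⊆ C

/-- The monophonic convex hull: the smallest m-convex set containing `S`. -/
def hull (G : SimpleGraph V) (S : Set V) : Set V :=
  ⋂₀ {C | Convex G C ∧ S ⊆ C}

/-- The set of monophonic halfspaces: m-convex sets with m-convex complement. -/
def halfspaces (G : SimpleGraph V) : Set (Set V) :=
  {H | Convex G H ∧ Convex G Hᶜ}

/-- `a ∈ A` and `b ∈ B` are mutual imprints: some `(a, b)`-path meets `A` only in `a` and `B`
only in `b`. -/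
def MutualImprints (G : SimpleGraph V) (A B : Set V) (a b : V) : Prop :=
  a ∈ A ∧ b ∈ B ∧ ∃ p : G.Walk a b, p.IsPath ∧
    ∀ x ∈ p.support, (x ∈ A → x = a) ∧ (x ∈ B → x = b)

/-- The imprint of `B` on `A`: all `a ∈ A` that form mutual imprints with some `b ∈ B`. -/
def imprint (G : SimpleGraph V) (A B : Set V) : Set V :=
  {a | ∃ b, MutualImprints G A B a b}

end Monophonic

/-! ### Sign vectors and labeled sample compression schemes -/

namespace Compression

variable {V : Type u}

/-- A sample over `V`, as a sign vector: the label `0` means that the point is absent. -/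
abbrev Sample (V : Type u) := V → SignType

/-- The positively labeled points. -/
def pos (X : Sample V) : Set V := {v | X v = 1}

/-- The negatively labeled points. -/
def neg (X : Sample V) : Set V := {v | X v = -1}

/-- The support of a sample. -/
def supp (X : Sample V) : Set V := {v | X v ≠ 0}

/-- The product order on `{-1, 0, 1}^V` for `0 ≼ -1` and `0 ≼ 1` (this is not the order
`-1 < 0 < 1` of `SignType`). -/
def Below (X Y : Sample V) : Prop := ∀ v, X v = 0 ∨ X v = Y v

open Classical in
/-- The `{-1, 1}`-vector of a hypothesis. -/
noncomputable def signVector (H : Set V) : Sample V := fun v => if v ∈ H then 1 else -1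

/-- The samples that are realizable by some hypothesis of `C`. -/
def realizable (C : Set (Set V)) : Set (Sample V) :=
  {X | ∃ H ∈ C, Below X (signVector H)}

/-- `(α, β)` is a labeled sample compression scheme of size `k` for `C`. The values of the
reconstructor `β` are hypotheses, that is, `{-1, 1}`-vectors. -/
def IsLSCS (C : Set (Set V)) (α : Sample V → Sample V) (β : Sample V → Set V) (k : ℕ) : Prop :=
  ∀ X ∈ realizable C,
    Below (α X) X ∧ Below X (signVector (β (α X))) ∧ (supp (α X)).ncard ≤ k

/-- The scheme is proper: reconstructed hypotheses belong to `C`. -/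
def IsProper (C : Set (Set V)) (α : Sample V → Sample V) (β : Sample V → Set V) : Prop :=
  ∀ X ∈ realizable C, β (α X) ∈ C

/-- The scheme is stable: dropping from a realizable sample any points that are not used for
its compression does not change the reconstructed hypothesis. -/
def IsStable (C : Set (Set V)) (α : Sample V → Sample V) (β : Sample V → Set V) : Prop :=
  ∀ X ∈ realizable C, ∀ X', Below (α X) X' → Below X' X → β (α X') = β (α X)

end Compression

/-! ### The scheme built from mutual imprints -/

namespace Monophonic

open Compression

variable {V : Type u} {n : ℕ}

/-- `(x, y)` is the lexicographically first pair of points of `S` whose hull contains `a`, for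
the order of the vertices given by the labeling `e`. -/
def IsFirstPair (G : SimpleGraph V) (e : V ≃ Fin n) (S : Set V) (a x y : V) : Prop :=
  x ∈ S ∧ y ∈ S ∧ a ∈ hull G {x, y} ∧
    ∀ x' ∈ S, ∀ y' ∈ S, a ∈ hull G {x', y'} → toLex (e x, e y) ≤ toLex (e x', e y')

/-- The union, over all `a ∈ I`, of the first pair of points of `S` whose hull contains `a`. -/
def firstPairs (G : SimpleGraph V) (e : V ≃ Fin n) (S I : Set V) : Set V :=
  {x | ∃ a ∈ I, ∃ y z, IsFirstPair G e S a y z ∧ (x = y ∨ x = z)}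

/-- The first vertex of `S`, as a set with at most one element (empty when `S` is). -/
def firstVertex (e : V ≃ Fin n) (S : Set V) : Set V :=
  {x | x ∈ S ∧ ∀ y ∈ S, e x ≤ e y}

open Classical in
/-- The points of `S` that are kept, where `S` is the set of points with one label and `T` the
set of points with the other: the first pairs that generate the imprint of the hull of `T` on
the hull of `S`. When `T` is empty there is no imprint, and the first vertex of `S` is kept. -/
noncomputable def keptPoints (G : SimpleGraph V) (e : V ≃ Fin n) (S T : Set V) : Set V :=
  if T = ∅ then firstVertex e S else firstPairs G e S (imprint G (hull G S) (hull G T))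

open Classical in
/-- The compressor. -/
noncomputable def compressor (G : SimpleGraph V) (e : V ≃ Fin n) (X : Sample V) : Sample V :=
  fun v =>
    if v ∈ keptPoints G e (pos X) (neg X) then 1
    else if v ∈ keptPoints G e (neg X) (pos X) then -1
    else 0

/-- `β` is a reconstructor for the compressor: on every compressed sample `Y`, it returns a
halfspace that separates the mutual imprints of the hulls of `Y⁺` and `Y⁻`. If only one label
occurs in `Y`, these imprints are empty, and the constant hypothesis with that label is returned. -/
def IsReconstructor (G : SimpleGraph V) (e : V ≃ Fin n) (β : Sample V → Set V) : Prop :=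
  ∀ Y ∈ compressor G e '' realizable (halfspaces G),
    β Y ∈ halfspaces G ∧
    imprint G (hull G (pos Y)) (hull G (neg Y)) ⊆ β Y ∧
    imprint G (hull G (neg Y)) (hull G (pos Y)) ⊆ (β Y)ᶜ ∧
    ((pos Y).Nonempty → neg Y = ∅ → β Y = Set.univ) ∧
    ((neg Y).Nonempty → pos Y = ∅ → β Y = ∅)

end Monophonic

/-! ### A random access machine

The machine has registers and two-dimensional arrays of natural numbers; a program mentions
finitely many of them. The arithmetic operations are addition and truncated subtraction (there
is no multiplication, so numbers gain only a bounded number of bits per step). Every evaluation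
of an operand, every arithmetic operation and every memory access costs one step. -/

namespace RAM

/-- The memory of the machine. -/
@[ext]
structure Store where
  /-- register contents -/
  reg : ℕ → ℕ
  /-- `arr a i j` is the entry in position `(i, j)` of the array named `a` -/
  arr : ℕ → ℕ → ℕ → ℕ

/-- Expressions. -/
inductive Expr
  | const (c : ℕ)
  | reg (x : ℕ)
  | read (a : ℕ) (i j : Expr)
  | add (e f : Expr)
  | sub (e f : Expr)

/-- The value of an expression; `sub` is truncated. -/
def Expr.eval (s : Store) : Expr → ℕ
  | .const c => c
  | .reg x => s.reg x
  | .read a i j => s.arr a (i.eval s) (j.eval s)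
  | .add e f => e.eval s + f.eval s
  | .sub e f => e.eval s - f.eval s

/-- The number of steps that the evaluation of an expression takes. -/
def Expr.cost : Expr → ℕ
  | .const _ => 1
  | .reg _ => 1
  | .read _ i j => i.cost + j.cost + 1
  | .add e f => e.cost + f.cost + 1
  | .sub e f => e.cost + f.cost + 1

/-- Programs: assignment to a register, assignment to an array entry, sequencing, branching and
`while` loops. A test succeeds when its value is not `0`. -/
inductive Program
  | skip
  | assign (x : ℕ) (e : Expr)
  | write (a : ℕ) (i j e : Expr)
  | seq (P Q : Program)
  | ite (b : Expr) (P Q : Program)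
  | loop (b : Expr) (P : Program)

/-- Writing to a register. -/
def Store.setReg (s : Store) (x c : ℕ) : Store :=
  { s with reg := Function.update s.reg x c }

/-- Writing to an array entry. -/
def Store.setArr (s : Store) (a i j c : ℕ) : Store :=
  { s with arr := fun a' i' j' => if a' = a ∧ i' = i ∧ j' = j then c else s.arr a' i' j' }

/-- `Runs P s t s'`: started in `s`, the program `P` halts after exactly `t` steps in `s'`. -/
inductive Runs : Program → Store → ℕ → Store → Prop
  | skip (s : Store) : Runs .skip s 1 s
  | assign (s : Store) (x : ℕ) (e : Expr) :
      Runs (.assign x e) s (e.cost + 1) (s.setReg x (e.eval s))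
  | write (s : Store) (a : ℕ) (i j e : Expr) :
      Runs (.write a i j e) s (i.cost + j.cost + e.cost + 1)
        (s.setArr a (i.eval s) (j.eval s) (e.eval s))
  | seq {P Q : Program} {s s' s'' : Store} {t t' : ℕ} :
      Runs P s t s' → Runs Q s' t' s'' → Runs (.seq P Q) s (t + t') s''
  | ite_true {b : Expr} {P Q : Program} {s s' : Store} {t : ℕ} :
      b.eval s ≠ 0 → Runs P s t s' → Runs (.ite b P Q) s (b.cost + 1 + t) s'
  | ite_false {b : Expr} {P Q : Program} {s s' : Store} {t : ℕ} :
      b.eval s = 0 → Runs Q s t s' → Runs (.ite b P Q) s (b.cost + 1 + t) s'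
  | loop_stop {b : Expr} {P : Program} {s : Store} :
      b.eval s = 0 → Runs (.loop b P) s (b.cost + 1) s
  | loop_step {b : Expr} {P : Program} {s s' s'' : Store} {t t' : ℕ} :
      b.eval s ≠ 0 → Runs P s t s' → Runs (.loop b P) s' t' s'' →
        Runs (.loop b P) s (b.cost + 1 + t + t') s''

open Compression

variable {V : Type u} {n : ℕ}

/-- The code of a label. -/
def labelCode (σ : SignType) : ℕ := if σ = 0 then 0 else if σ = 1 then 1 else 2

open Classical in
/-- The input store for a labeled graph and a sample: register `0` holds the number of vertices,
array `0` the adjacency matrix, column `0` of array `1` the sample; everything else is `0`. -/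
noncomputable def inputStore (G : SimpleGraph V) (e : V ≃ Fin n) (X : Sample V) : Store where
  reg x := if x = 0 then n else 0
  arr a i j :=
    if h : i < n ∧ j < n ∧ a = 0 then
      if G.Adj (e.symm ⟨i, h.1⟩) (e.symm ⟨j, h.2.1⟩) then 1 else 0
    else if h : i < n ∧ j = 0 ∧ a = 1 then labelCode (X (e.symm ⟨i, h.1⟩))
    else 0

/-- On input `(G, X)`, the program `P` halts after at most `t` steps with the sign vector `Y`
in column `0` of array `2`. -/
def Outputs (P : Program) (G : SimpleGraph V) (e : V ≃ Fin n) (X Y : Sample V) (t : ℕ) : Prop :=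
  ∃ t' ≤ t, ∃ s : Store, Runs P (inputStore G e X) t' s ∧
    ∀ v, s.arr 2 (e v) 0 = labelCode (Y v)

end RAM

/-!
# Compression of monophonic halfspaces

*The scheme.* A shortest walk inside a set is an induced path (`exists_isInducedPath`), so two
non-adjacent points of an m-convex set `C` cannot be joined by a walk with interior outside of `C`
(`Convex.adj_of_walk`). Hence the imprints of two disjoint convex sets on each other are cliques
(`isClique_imprint`), and the compressor keeps at most two points for each of at most `2ω`
imprints. The pairs it looks for exist because the Carathéodory number of monophonic convexity is at
most two (`exists_pair_of_mem_hull`): the points outside a hull are those that a clique separates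
from the generators, and if three pairwise incomparable clique separators are such that every
generator is separated by two of them, then the points that lie on two of the three form a clique
separating all generators (`exists_isCliqueCut_of_three`). The imprints of the hulls do not change
when points are removed that the compressor drops (`imprint_eq_of_subset`), which gives stability;
and a halfspace that separates the imprints separates the hulls (`subset_of_imprint_subset`), which
gives consistency with the sample.

*The reconstructor.* In a connected graph, `H` is a halfspace if and only if no two non-adjacent
vertices on one side both have a neighbour on the other side. Every such constraint involves four
vertices, but once the ends `a ∈ H` and `b ∉ H` of one edge are fixed, unit propagation leaves
constraints on at most two vertices, as in 2-SAT. So a greedy algorithm without backtracking is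
correct: it signs one free vertex after the other, positively if unit propagation stays consistent
and negatively otherwise (`IsAdmissible.override`, `exists_greedy_eq_lits`). The reconstructor takes
the first pair `(a, b)` for which this yields a halfspace consistent with the sample.

*Running time.* Properties that are built from the input by Boolean operations, quantifiers over
vertices, and iteration of definable operators on sets of signed vertices are decided by programs
in polynomial time (`Comp.and`, `Comp.not`, `Comp.ex`, `Comp.iterate`), by induction on the way they
are built. Least fixed points of monotone operators are such iterations. It remains to describe
hulls, imprints, the compressor and the greedy algorithm in these terms. Hulls are generated by
reachability conditions (`isLeast_hull`), although it is hard to decide whether a vertex is on an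
induced path between two given vertices.
-/

/-! ### Induced paths and flooding -/

namespace Monophonic

variable {V : Type u} {G : SimpleGraph V}

/-- A shortest walk inside `D` is an induced path. -/
lemma exists_isInducedPath {D : Set V} {u v : V} (p : G.Walk u v) (hp : ∀ x ∈ p.support, x ∈ D) :
    ∃ q : G.Walk u v, IsInducedPath G q ∧ ∀ x ∈ q.support, x ∈ D := by
  classical
  have hex : ∃ k, ∃ q : G.Walk u v, q.length = k ∧ ∀ x ∈ q.support, x ∈ D := ⟨_, p, rfl, hp⟩
  obtain ⟨q₀, hq₀, hq₀D⟩ := Nat.find_spec hex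
  have hmin : ∀ r : G.Walk u v, (∀ x ∈ r.support, x ∈ D) → q₀.length ≤ r.length := fun r hr =>
    hq₀ ▸ Nat.find_min' hex ⟨r, rfl, hr⟩
  have hqD : ∀ x ∈ q₀.bypass.support, x ∈ D := fun x hx =>
    hq₀D x (q₀.support_bypass_subset_support hx)
  have hlen : q₀.bypass.length ≤ q₀.length := q₀.length_bypass_le_length
  generalize hq : q₀.bypass = q at hqD hlen
  have hpath : q.IsPath := hq ▸ q₀.bypass_isPath
  refine ⟨q, ⟨hpath, ?_⟩, hqD⟩
  -- Going from `x` to `y` directly must not be a shortcut.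
  have key : ∀ x y (q₁ : G.Walk u x) (q₂ : G.Walk x y) (q₃ : G.Walk y v),
      q = q₁.append (q₂.append q₃) → G.Adj x y → s(x, y) ∈ q.edges := by
    intro x y q₁ q₂ q₃ hq hxy
    have h1 := hmin (q₁.append (.cons hxy q₃)) (by
      intro z hz
      rw [SimpleGraph.Walk.mem_support_append_iff, SimpleGraph.Walk.support_cons,
        List.mem_cons] at hz
      apply hqD z
      rw [hq, SimpleGraph.Walk.mem_support_append_iff, SimpleGraph.Walk.mem_support_append_iff]
      rcases hz with hz | rfl | hz
      · exact Or.inl hz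
      · exact Or.inl q₁.end_mem_support
      · exact Or.inr (Or.inr hz))
    rw [hq, SimpleGraph.Walk.edges_append, SimpleGraph.Walk.edges_append]
    have h2 := congrArg SimpleGraph.Walk.length hq
    simp only [SimpleGraph.Walk.length_append, SimpleGraph.Walk.length_cons] at h1 h2
    clear hq
    cases q₂ with
    | nil => exact absurd hxy G.irrefl
    | cons h r' =>
      cases r' with
      | nil => simp
      | cons h' r'' => simp only [SimpleGraph.Walk.length_cons] at h2; omega
  intro x hx y hy hxy
  obtain ⟨q₁, r, hq₁⟩ := SimpleGraph.Walk.mem_support_iff_exists_append.1 hx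
  rw [hq₁, SimpleGraph.Walk.mem_support_append_iff] at hy
  rcases hy with hy | hy
  · obtain ⟨a, b, rfl⟩ := SimpleGraph.Walk.mem_support_iff_exists_append.1 hy
    rw [Sym2.eq_swap]
    exact key y x a b r (by rw [hq₁, SimpleGraph.Walk.append_assoc]) hxy.symm
  · obtain ⟨a, b, rfl⟩ := SimpleGraph.Walk.mem_support_iff_exists_append.1 hy
    exact key x y q₁ a b hq₁ hxy

/-- The vertices that are reached from `S` by walks whose vertices after the first lie in `D`. -/
inductive Flood (G : SimpleGraph V) (S D : Set V) : V → Prop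
  | base {x : V} : x ∈ S → Flood G S D x
  | step {x y : V} : Flood G S D x → G.Adj x y → y ∈ D → Flood G S D y

lemma Flood.exists_walk {S D : Set V} {z : V} (h : Flood G S D z) :
    ∃ s ∈ S, ∃ p : G.Walk s z, ∀ x ∈ p.support, x = s ∨ x ∈ D := by
  induction h with
  | base h => exact ⟨_, h, .nil, by simp⟩
  | step _ hxy hy ih =>
    obtain ⟨s, hs, p, hp⟩ := ih
    refine ⟨s, hs, p.concat hxy, fun x hx => ?_⟩
    rw [SimpleGraph.Walk.support_concat, List.mem_append, List.mem_singleton] at hx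
    rcases hx with hx | rfl
    · exact hp x hx
    · exact Or.inr hy

lemma Flood.walk {S D : Set V} {s z : V} (hs : Flood G S D s) (p : G.Walk s z)
    (hp : ∀ x ∈ p.support.tail, x ∈ D) : Flood G S D z := by
  induction p with
  | nil => exact hs
  | cons h q ih =>
    simp only [SimpleGraph.Walk.support_cons, List.tail_cons] at hp
    exact ih (hs.step h (hp _ q.start_mem_support)) fun x hx => hp x (List.mem_of_mem_tail hx)

lemma Flood.mono {S S' D D' : Set V} (hS : S ⊆ S') (hD : D ⊆ D') {z : V} (h : Flood G S D z) :
    Flood G S' D' z := by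
  induction h with
  | base h => exact .base (hS h)
  | step _ hxy hy ih => exact ih.step hxy (hD hy)

/-- A walk leaving a set does so along an edge. -/
lemma exists_adj_of_walk {T : Set V} {u v : V} (p : G.Walk u v) (hu : u ∈ T) (hv : v ∉ T) :
    ∃ x ∈ p.support, ∃ y ∈ p.support, G.Adj x y ∧ x ∈ T ∧ y ∉ T := by
  obtain ⟨d, hd, h1, h2⟩ := p.exists_boundary_dart T hu hv
  exact ⟨d.fst, p.dart_fst_mem_support_of_mem_darts hd, d.snd,
    p.dart_snd_mem_support_of_mem_darts hd, d.adj, h1, h2⟩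

/-! ### Monophonic hulls -/

lemma subset_hull (S : Set V) : S ⊆ hull G S := fun _ hx _ hC => hC.2 hx

lemma hull_subset {S C : Set V} (hC : Convex G C) (h : S ⊆ C) : hull G S ⊆ C :=
  fun _ hx => hx C ⟨hC, h⟩

lemma hull_mono {S T : Set V} (h : S ⊆ T) : hull G S ⊆ hull G T :=
  fun _ hx C hC => hx C ⟨hC.1, h.trans hC.2⟩

lemma convex_hull (S : Set V) : Convex G (hull G S) := fun u hu v hv _ hw C hC =>
  hC.1 u (hu C hC) v (hv C hC) hw

lemma hull_empty : hull G (∅ : Set V) = ∅ :=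
  Set.subset_empty_iff.1 (hull_subset (fun _ h => h.elim) le_rfl)

/-- Two vertices of a convex set that are joined by a walk with interior outside of it are equal
or adjacent. -/
lemma Convex.adj_of_walk {C : Set V} (hC : Convex G C) {u v : V} (hu : u ∈ C) (hv : v ∈ C)
    (p : G.Walk u v) (hp : ∀ x ∈ p.support, x ∈ C → x = u ∨ x = v) (huv : u ≠ v) :
    G.Adj u v := by
  obtain ⟨q, hq, hqD⟩ := exists_isInducedPath (D := {x | x ∈ C → x = u ∨ x = v}) p hp
  cases q with
  | nil => exact absurd rfl huv
  | @cons _ w _ h r =>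
    have hw : w ∈ (SimpleGraph.Walk.cons h r).support := by simp
    rcases hqD w hw (hC u hu v hv ⟨_, hq, hw⟩) with rfl | rfl
    · exact absurd h G.irrefl
    · exact h

/-- Convex sets of a connected graph are connected. -/
lemma Convex.exists_walk (hG : G.Connected) {C : Set V} (hC : Convex G C) {u v : V} (hu : u ∈ C)
    (hv : v ∈ C) : ∃ p : G.Walk u v, ∀ x ∈ p.support, x ∈ C := by
  obtain ⟨p⟩ := hG.preconnected u v
  obtain ⟨q, hq, -⟩ := exists_isInducedPath (D := Set.univ) p (fun _ _ => trivial)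
  exact ⟨q, fun x hx => hC u hu v hv ⟨q, hq, hx⟩⟩

/-- One round of a closure rule for convexity that only uses reachability: a neighbour `w` of
`u ∈ C` is added if it has a neighbour in a component of `G - N[u]` that meets `C`. -/
def hullStep (G : SimpleGraph V) (S C : Set V) : Set V :=
  {w | w ∈ S ∨ ∃ u ∈ C, G.Adj u w ∧
    ∃ z, Flood G {v | v ∈ C ∧ v ≠ u ∧ ¬ G.Adj u v} {v | v ≠ u ∧ ¬ G.Adj u v} z ∧ G.Adj w z}

lemma hullStep_mono (S : Set V) : Monotone (hullStep G S) := by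
  rintro C C' h w (hw | ⟨u, hu, huw, z, hz, hwz⟩)
  · exact Or.inl hw
  · refine Or.inr ⟨u, h hu, huw, z, hz.mono ?_ le_rfl, hwz⟩
    exact fun v hv => ⟨h hv.1, hv.2⟩

lemma Convex.hullStep_subset {S C : Set V} (hC : Convex G C) (hS : S ⊆ C) :
    hullStep G S C ⊆ C := by
  rintro w (hw | ⟨u, hu, huw, z, hz, hwz⟩)
  · exact hS hw
  · obtain ⟨v, ⟨hvC, hvu, huv⟩, p, hp⟩ := hz.exists_walk
    obtain ⟨q, hq, hqD⟩ := exists_isInducedPath (D := {x | x = u ∨ x = w ∨ ¬ G.Adj u x})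
      (.cons huw (.cons hwz p.reverse)) (by
        intro x hx
        simp only [SimpleGraph.Walk.support_cons, SimpleGraph.Walk.support_reverse,
          List.mem_cons, List.mem_reverse] at hx
        rcases hx with rfl | rfl | hx
        · exact Or.inl rfl
        · exact Or.inr (Or.inl rfl)
        · rcases hp x hx with rfl | h
          · exact Or.inr (Or.inr huv)
          · exact Or.inr (Or.inr h.2))
    refine hC u hu v hvC ⟨q, hq, ?_⟩
    -- The second vertex of the induced path `q` is adjacent to `u`, so it is `w`.
    cases q with
    | nil => exact absurd rfl hvu
    | @cons _ w' _ h r =>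
      have hw : w' ∈ (SimpleGraph.Walk.cons h r).support := by simp
      rcases hqD w' hw with rfl | rfl | h'
      · exact absurd h G.irrefl
      · exact hw
      · exact absurd h h'

lemma IsInducedPath.of_cons {u v w : V} {h : G.Adj u w} {q : G.Walk w v}
    (hq : IsInducedPath G (.cons h q)) : IsInducedPath G q := by
  refine ⟨hq.1.of_cons, fun x hx y hy hxy => ?_⟩
  have h1 := hq.2 x (by simp [hx]) y (by simp [hy]) hxy
  have hu := ((SimpleGraph.Walk.cons_isPath_iff _ _).1 hq.1).2
  rw [SimpleGraph.Walk.edges_cons, List.mem_cons, Sym2.eq_iff] at h1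
  rcases h1 with (⟨rfl, -⟩ | ⟨-, rfl⟩) | h1
  · exact absurd hx hu
  · exact absurd hy hu
  · exact h1

lemma convex_of_hullStep_subset {S C : Set V} (hC : hullStep G S C ⊆ C) : Convex G C := by
  rintro u hu v hv x ⟨p, hp, hx⟩
  induction p with
  | nil => simp only [SimpleGraph.Walk.support_nil, List.mem_singleton] at hx; exact hx ▸ hu
  | @cons u w v h q ih =>
    have hw : w ∈ C := by
      cases q with
      | nil => exact hv
      | @cons _ z _ h' r =>
        have hpath := (SimpleGraph.Walk.cons_isPath_iff _ _).1 hp.1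
        have hwr := ((SimpleGraph.Walk.cons_isPath_iff _ _).1 hpath.1).2
        have hr : ∀ y ∈ r.support, y ≠ u ∧ ¬ G.Adj u y := by
          intro y hy
          refine ⟨fun hyu => hpath.2 (hyu ▸ by simp [hy]), fun huy => ?_⟩
          have h1 := hp.2 u (by simp) y (by simp [hy]) huy
          rw [SimpleGraph.Walk.edges_cons, List.mem_cons, Sym2.eq_iff] at h1
          rcases h1 with (⟨-, rfl⟩ | ⟨h2, -⟩) | h1
          · exact hwr hy
          · exact h.ne h2
          · exact hpath.2 (SimpleGraph.Walk.fst_mem_support_of_mem_edges _ h1)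
        refine hC (Or.inr ⟨u, hu, h, z, ?_, h'⟩)
        refine Flood.walk (.base ⟨hv, hr v r.end_mem_support⟩) r.reverse fun y hy => hr y ?_
        simpa using List.mem_of_mem_tail hy
    rw [SimpleGraph.Walk.support_cons, List.mem_cons] at hx
    rcases hx with rfl | hx
    · exact hu
    · exact ih hw hv hp.of_cons hx

lemma isLeast_hull (S : Set V) : IsLeast {C | hullStep G S C ⊆ C} (hull G S) :=
  ⟨(convex_hull S).hullStep_subset (subset_hull S),
    fun _ hC => hull_subset (convex_of_hullStep_subset hC) fun _ hx => hC (Or.inl hx)⟩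

/-! ### The Carathéodory number of monophonic convexity -/

/-- `D` is a connected set around `m` whose outer boundary is a clique. -/
structure IsCliqueCut (G : SimpleGraph V) (m : V) (D : Set V) : Prop where
  mem : m ∈ D
  connected : ∀ d ∈ D, Flood G {m} D d
  clique : ∀ c c' d d', d ∈ D → d' ∈ D → c ∉ D → c' ∉ D → G.Adj d c → G.Adj d' c' → c ≠ c' →
    G.Adj c c'

/-- The connected part of `D` around `m`. -/
lemma isCliqueCut_flood {m : V} {D : Set V} (hm : m ∈ D)
    (clique : ∀ c c' d d', d ∈ D → d' ∈ D → c ∉ D → c' ∉ D → G.Adj d c → G.Adj d' c' → c ≠ c' →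
      G.Adj c c') : IsCliqueCut G m {x | Flood G {m} D x} ∧ {x | Flood G {m} D x} ⊆ D := by
  have hsub : {x | Flood G {m} D x} ⊆ D := by
    intro x hx
    obtain (h | ⟨-, -, h⟩) := hx
    · rw [Set.mem_singleton_iff.1 h]; exact hm
    · exact h
  refine ⟨⟨.base rfl, fun d hd => ?_, ?_⟩, hsub⟩
  · induction id hd with
    | base h => exact .base h
    | step h hxy hy ih => exact (ih h).step hxy (h.step hxy hy)
  · intro c c' d d' hd hd' hc hc' h h' hne
    exact clique c c' d d' (hsub hd) (hsub hd') (fun hcD => hc (Flood.step hd h hcD))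
      (fun hcD => hc' (Flood.step hd' h' hcD)) h h' hne

/-- The complement of a set is convex if the outer boundary of the set is a clique: an induced path
that enters the set would do so between two adjacent vertices. -/
lemma convex_compl_of_clique {D : Set V}
    (clique : ∀ c c' d d', d ∈ D → d' ∈ D → c ∉ D → c' ∉ D → G.Adj d c → G.Adj d' c' → c ≠ c' →
      G.Adj c c') : Convex G Dᶜ := by
  rintro u hu v hv x ⟨p, hp, hx⟩
  intro hxD
  classical
  obtain ⟨c, hc, d, hd, hcd, hcC, hdD⟩ := exists_adj_of_walk (p.takeUntil x hx) hu
    (fun h => h hxD)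
  obtain ⟨d', hd', c', hc', hcd', hdD', hcC'⟩ := exists_adj_of_walk (p.dropUntil x hx) hxD hv
  rw [Set.mem_compl_iff, not_not] at hdD
  have hpath : ((p.takeUntil x hx).append (p.dropUntil x hx)).IsPath := by
    rw [p.take_spec]; exact hp.1
  have hxc : x ≠ c := fun h => hcC (h ▸ hxD)
  have hxc' : x ≠ c' := fun h => hcC' (h ▸ hxD)
  have hdisj : ∀ y ∈ (p.takeUntil x hx).support, y ∈ (p.dropUntil x hx).support → y = x := by
    intro y hy hy'
    have h1 := hpath.support_nodup
    rw [SimpleGraph.Walk.support_append, List.nodup_append] at h1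
    by_contra hne
    rw [SimpleGraph.Walk.mem_support_iff] at hy'
    rcases hy' with h | h
    · exact hne h
    · exact h1.2.2 y hy y h rfl
  have hne : c ≠ c' := by
    rintro rfl
    exact hxc (hdisj c hc hc').symm
  have hadj := clique c c' d d' hdD hdD' hcC hcC' hcd.symm hcd' hne
  have hedge := hp.2 c (p.support_takeUntil_subset_support hx hc) c'
    (p.support_dropUntil_subset_support hx hc') hadj
  rw [← p.take_spec hx, SimpleGraph.Walk.edges_append, List.mem_append] at hedge
  rcases hedge with h | h
  · exact hxc' (hdisj c' (SimpleGraph.Walk.snd_mem_support_of_mem_edges _ h) hc').symm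
  · exact hxc (hdisj c hc (SimpleGraph.Walk.fst_mem_support_of_mem_edges _ h)).symm

/-- The vertices outside the hull of `S` are those that a clique separates from `S`. -/
lemma notMem_hull_iff {S : Set V} {m : V} :
    m ∉ hull G S ↔ ∃ D, IsCliqueCut G m D ∧ Disjoint D S := by
  constructor
  · intro hm
    -- The component of `m` outside of the hull has a clique as its boundary.
    set D : Set V := {x | Flood G {m} (hull G S)ᶜ x} with hDdef
    have hsub : D ⊆ (hull G S)ᶜ := by
      intro x hx
      obtain (h | ⟨-, -, h⟩) := hx
      · rw [Set.mem_singleton_iff.1 h]; exact hm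
      · exact h
    refine ⟨D, ⟨.base rfl, fun d hd => ?_, ?_⟩,
      Set.disjoint_left.2 fun x hx hxS => hsub hx (subset_hull S hxS)⟩
    · induction id hd with
      | base h => exact .base h
      | step h hxy hy ih => exact (ih h).step hxy (h.step hxy hy)
    · intro c c' d d' hd hd' hc hc' h h' hne
      have hcH : ∀ c d, d ∈ D → c ∉ D → G.Adj d c → c ∈ hull G S := fun c d hd hc h => by
        by_contra hcn
        exact hc (Flood.step hd h hcn)
      obtain ⟨s, rfl, p, hp⟩ := Flood.exists_walk hd
      obtain ⟨s', rfl, p', hp'⟩ := Flood.exists_walk hd'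
      refine (convex_hull S).adj_of_walk (hcH c d hd hc h) (hcH c' d' hd' hc' h')
        (.cons h.symm (p.reverse.append (p'.concat h'))) (fun x hx hxH => ?_) hne
      simp only [SimpleGraph.Walk.support_cons, List.mem_cons,
        SimpleGraph.Walk.mem_support_append_iff, SimpleGraph.Walk.support_reverse,
        List.mem_reverse, SimpleGraph.Walk.support_concat, List.mem_append,
        List.not_mem_nil, or_false] at hx
      rcases hx with rfl | hx | hx | rfl
      · exact Or.inl rfl
      · rcases hp x hx with rfl | hx
        · exact absurd hxH hm
        · exact absurd hxH hx
      · rcases hp' x hx with rfl | hx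
        · exact absurd hxH hm
        · exact absurd hxH hx
      · exact Or.inr rfl
  · rintro ⟨D, hD, hDS⟩ hm
    exact hull_subset (convex_compl_of_clique hD.clique)
      (fun x hxS hxD => Set.disjoint_left.1 hDS hxD hxS) hm hD.mem

/-- If two clique cuts around `m` are incomparable, then each boundary vertex of the first lies in
the second or on its boundary. -/
lemma IsCliqueCut.boundary_subset {m : V} {D₁ D₂ : Set V} (h₁ : IsCliqueCut G m D₁)
    (h₂ : IsCliqueCut G m D₂) (h : ¬ D₂ ⊆ D₁) {c d : V} (hd : d ∈ D₁) (hc : c ∉ D₁)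
    (hdc : G.Adj d c) : c ∈ D₂ ∨ ∃ d' ∈ D₂, G.Adj d' c := by
  obtain ⟨y, hy, hy1⟩ := Set.not_subset.1 h
  obtain ⟨s, rfl, p, hp⟩ := (h₂.connected y hy).exists_walk
  obtain ⟨x, hx, k, hk, hxk, hxD, hkD⟩ := exists_adj_of_walk p h₁.mem hy1
  have hk2 : k ∈ D₂ := (hp k hk).elim (fun h => h ▸ h₂.mem) id
  by_cases hck : c = k
  · exact Or.inl (hck ▸ hk2)
  · exact Or.inr ⟨k, hk2, h₁.clique k c x d hxD hd hkD hc hxk hdc (Ne.symm hck)⟩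

/-- Two incomparable clique cuts: the outer boundary of their union is contained in both of
their boundaries. -/
lemma IsCliqueCut.union_boundary {m : V} {D₁ D₂ : Set V} (h₁ : IsCliqueCut G m D₁)
    (h₂ : IsCliqueCut G m D₂) (h12 : ¬ D₁ ⊆ D₂) (h21 : ¬ D₂ ⊆ D₁) {p q : V} (hpq : G.Adj p q)
    (hp : p ∈ D₁ ∪ D₂) (hq : q ∉ D₁ ∪ D₂) : (∃ d ∈ D₁, G.Adj d q) ∧ ∃ d ∈ D₂, G.Adj d q := by
  have hq1 : q ∉ D₁ := fun h => hq (Or.inl h)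
  have hq2 : q ∉ D₂ := fun h => hq (Or.inr h)
  rcases hp with hp | hp
  · exact ⟨⟨p, hp, hpq⟩, (h₁.boundary_subset h₂ h21 hp hq1 hpq).resolve_left hq2⟩
  · exact ⟨(h₂.boundary_subset h₁ h12 hp hq2 hpq).resolve_left hq1, ⟨p, hp, hpq⟩⟩

/-- If three clique cuts around `m` are such that every point of `S` is avoided by two of them,
then one clique cut avoids `S`: if no two cuts are comparable, the vertices that lie on two of
the three boundaries form a clique that separates `m` from `S`. -/
lemma exists_isCliqueCut_of_three {S : Set V} {m : V} {D : Fin 3 → Set V}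
    (hD : ∀ i, IsCliqueCut G m (D i))
    (hS : ∀ s ∈ S, ∃ i j, i ≠ j ∧ s ∉ D i ∧ s ∉ D j) :
    ∃ E, IsCliqueCut G m E ∧ Disjoint E S := by
  by_cases hcomp : ∃ i j, i ≠ j ∧ D i ⊆ D j
  · obtain ⟨i, j, hij, hsub⟩ := hcomp
    refine ⟨D i, hD i, Set.disjoint_left.2 fun s hs hsS => ?_⟩
    obtain ⟨k, l, hkl, hk, hl⟩ := hS s hsS
    have hki : k ≠ i := by rintro rfl; exact hk hs
    have hkj : k ≠ j := by rintro rfl; exact hk (hsub hs)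
    have hli : l ≠ i := by rintro rfl; exact hl hs
    have hlj : l ≠ j := by rintro rfl; exact hl (hsub hs)
    omega
  push Not at hcomp
  set K : Set V := {x | ∃ i j, i ≠ j ∧ (x ∉ D i ∧ ∃ d ∈ D i, G.Adj d x) ∧
    (x ∉ D j ∧ ∃ d ∈ D j, G.Adj d x)} with hK
  have hKclique : ∀ c c', c ∈ K → c' ∈ K → c ≠ c' → G.Adj c c' := by
    rintro c c' ⟨i, j, hij, hi, hj⟩ ⟨i', j', hij', hi', hj'⟩ hne
    have key : ∀ k, (c ∉ D k ∧ ∃ d ∈ D k, G.Adj d c) → (c' ∉ D k ∧ ∃ d ∈ D k, G.Adj d c') →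
        G.Adj c c' := by
      rintro k ⟨h1, d, hd, hdc⟩ ⟨h1', d', hd', hdc'⟩
      exact (hD k).clique c c' d d' hd hd' h1 h1' hdc hdc' hne
    have : i = i' ∨ i = j' ∨ j = i' ∨ j = j' := by omega
    rcases this with rfl | rfl | rfl | rfl
    · exact key _ hi hi'
    · exact key _ hi hj'
    · exact key _ hj hi'
    · exact key _ hj hj'
  have hmK : m ∈ Kᶜ := by
    rintro ⟨i, j, hij, hi, hj⟩
    exact hi.1 (hD i).mem
  obtain ⟨h1, h2⟩ := isCliqueCut_flood (G := G) hmK fun c c' d d' _ _ hc hc' _ _ hne =>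
    hKclique c c' (not_not.1 hc) (not_not.1 hc') hne
  refine ⟨_, h1, Set.disjoint_left.2 fun s hs hsS => ?_⟩
  obtain ⟨i, j, hij, hi, hj⟩ := hS s hsS
  obtain ⟨m', rfl, p, hp⟩ := Flood.exists_walk hs
  obtain ⟨x, hx, y, hy, hxy, hxD, hyD⟩ := exists_adj_of_walk (T := D i ∪ D j) p
    (Or.inl (hD i).mem) (fun h => h.elim hi hj)
  obtain ⟨h3, h4⟩ := (hD i).union_boundary (hD j) (hcomp i j hij) (hcomp j i hij.symm) hxy hxD hyD
  have hyK : y ∈ K := ⟨i, j, hij, ⟨fun h => hyD (Or.inl h), h3⟩, ⟨fun h => hyD (Or.inr h), h4⟩⟩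
  rcases hp y hy with rfl | h
  · exact hmK hyK
  · exact h hyK

/-- Every point of the hull of `S` is in the hull of two points of `S`. -/
lemma exists_pair_of_mem_hull [Finite V] {S : Set V} {m : V} (hm : m ∈ hull G S) :
    ∃ x ∈ S, ∃ y ∈ S, m ∈ hull G {x, y} := by
  -- If a minimal subset that generates `m` had three points, then omitting each of them would give
  -- three clique cuts, and every point of the subset would be avoided by two of them.
  obtain ⟨T, hTS, hT⟩ := (Set.toFinite {T : Set V | m ∈ hull G T}).exists_le_minimal hm
  have hmin : ∀ x ∈ T, m ∉ hull G (T \ {x}) := fun x hx h =>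
    (hT.2 h Set.sdiff_subset hx).2 rfl
  have hTne : T.Nonempty := by
    rw [Set.nonempty_iff_ne_empty]
    rintro rfl
    have h : m ∈ hull G ∅ := hT.1
    rwa [hull_empty] at h
  obtain ⟨x, hx⟩ := hTne
  by_cases hy : ∃ y ∈ T, y ≠ x
  · obtain ⟨y, hy, hyx⟩ := hy
    by_cases hz : ∃ z ∈ T, z ≠ x ∧ z ≠ y
    · exfalso
      obtain ⟨z, hz, hzx, hzy⟩ := hz
      have hmem : ∀ i : Fin 3, (![x, y, z]) i ∈ T := by
        intro i; fin_cases i <;> assumption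
      have hinj : Function.Injective ![x, y, z] := by
        intro i j hij
        fin_cases i <;> fin_cases j <;> simp_all
      choose D hD hDS using fun i => notMem_hull_iff.1 (hmin _ (hmem i))
      refine notMem_hull_iff.2 (exists_isCliqueCut_of_three hD (S := T) fun s hs => ?_) hT.1
      have hav : ∀ i, s ≠ (![x, y, z]) i → s ∉ D i := fun i hi hsD =>
        Set.disjoint_left.1 (hDS i) hsD ⟨hs, hi⟩
      by_cases h0 : ∃ k, s = (![x, y, z]) k
      · obtain ⟨k, rfl⟩ := h0
        have hk : k + 1 ≠ k + 2 ∧ k ≠ k + 1 ∧ k ≠ k + 2 := by fin_cases k <;> decide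
        exact ⟨k + 1, k + 2, hk.1, hav _ fun h => hk.2.1 (hinj h), hav _ fun h => hk.2.2 (hinj h)⟩
      · push Not at h0
        exact ⟨0, 1, by decide, hav _ (h0 _), hav _ (h0 _)⟩
    · push Not at hz
      refine ⟨x, hTS hx, y, hTS hy, hull_mono (fun z hzT => ?_) hT.1⟩
      by_cases hzx : z = x
      · exact Or.inl hzx
      · exact Or.inr (hz z hzT hzx)
  · push Not at hy
    exact ⟨x, hTS hx, x, hTS hx, hull_mono (fun z hz => Or.inl (hy z hz)) hT.1⟩

end Monophonic

/-! ### Signed samples -/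

namespace Compression

variable {V : Type u}

lemma pos_signVector (H : Set V) : pos (signVector H) = H := by
  ext v
  change signVector H v = 1 ↔ _
  by_cases h : v ∈ H <;> simp [signVector, h]

lemma neg_signVector (H : Set V) : neg (signVector H) = Hᶜ := by
  ext v
  change signVector H v = -1 ↔ _
  by_cases h : v ∈ H <;> simp [signVector, h]

end Compression

/-! ### Mutual imprints -/

namespace Monophonic

open Compression

variable {V : Type u} {n : ℕ} {G : SimpleGraph V}

lemma imprint_subset (A B : Set V) : imprint G A B ⊆ A := fun _ ⟨_, h⟩ => h.1

lemma MutualImprints.symm {A B : Set V} {a b : V} (h : MutualImprints G A B a b) :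
    MutualImprints G B A b a := by
  obtain ⟨ha, hb, p, hp, h⟩ := h
  exact ⟨hb, ha, p.reverse, hp.reverse, fun x hx => (h x (by simpa using hx)).symm⟩

lemma MutualImprints.mem_imprint_right {A B : Set V} {a b : V} (h : MutualImprints G A B a b) :
    b ∈ imprint G B A := ⟨a, h.symm⟩

/-- Every walk from `A` to `B` contains a path between mutual imprints. -/
lemma exists_mutualImprints {A B : Set V} {u v : V} (p : G.Walk u v) (hu : u ∈ A) (hv : v ∈ B) :
    ∃ a b, MutualImprints G A B a b ∧ a ∈ p.support ∧ b ∈ p.support := by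
  classical
  -- A shortest walk from `A` to `B` inside the support of `p` has the required property.
  have hex : ∃ k, ∃ (a b : V) (q : G.Walk a b), q.length = k ∧ a ∈ A ∧ b ∈ B ∧
    ∀ x ∈ q.support, x ∈ p.support := ⟨_, u, v, p, rfl, hu, hv, fun _ h => h⟩
  obtain ⟨a, b, q, hq, ha, hb, hqp⟩ := Nat.find_spec hex
  have hmin : ∀ (a' b' : V) (r : G.Walk a' b'), a' ∈ A → b' ∈ B →
      (∀ x ∈ r.support, x ∈ p.support) → q.length ≤ r.length := fun a' b' r h1 h2 h3 =>
    hq ▸ Nat.find_min' hex ⟨a', b', r, rfl, h1, h2, h3⟩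
  have hsub := q.support_bypass_subset_support
  have hlen := q.length_bypass_le_length
  refine ⟨a, b, ⟨ha, hb, q.bypass, q.bypass_isPath, fun x hx => ?_⟩, hqp a q.start_mem_support,
    hqp b q.end_mem_support⟩
  obtain ⟨q₁, q₂, hq₁₂⟩ := SimpleGraph.Walk.mem_support_iff_exists_append.1 hx
  have hl := congrArg SimpleGraph.Walk.length hq₁₂
  rw [SimpleGraph.Walk.length_append] at hl
  have hq₁ : ∀ y ∈ q₁.support, y ∈ p.support := fun y hy => hqp y (hsub (by
    rw [hq₁₂, SimpleGraph.Walk.mem_support_append_iff]; exact Or.inl hy))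
  have hq₂ : ∀ y ∈ q₂.support, y ∈ p.support := fun y hy => hqp y (hsub (by
    rw [hq₁₂, SimpleGraph.Walk.mem_support_append_iff]; exact Or.inr hy))
  constructor
  · intro hxA
    have := hmin x b q₂ hxA hb hq₂
    exact (SimpleGraph.Walk.eq_of_length_eq_zero (p := q₁) (by omega)).symm
  · intro hxB
    have := hmin a x q₁ ha hxB hq₁
    exact SimpleGraph.Walk.eq_of_length_eq_zero (p := q₂) (by omega)

lemma imprint_nonempty (hG : G.Connected) {A B : Set V} (hA : A.Nonempty) (hB : B.Nonempty) :
    (imprint G A B).Nonempty := by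
  obtain ⟨u, hu⟩ := hA
  obtain ⟨v, hv⟩ := hB
  obtain ⟨p⟩ := hG.preconnected u v
  obtain ⟨a, b, h, -⟩ := exists_mutualImprints p hu hv
  exact ⟨a, b, h⟩

/-- The imprint on a convex set is a clique: two of its vertices are joined through the other
set, which is connected. -/
lemma isClique_imprint (hG : G.Connected) {A B : Set V} (hA : Convex G A) (hB : Convex G B)
    (hAB : Disjoint A B) : G.IsClique (imprint G A B) := by
  rintro a ⟨b, ha, hb, p, -, hp⟩ a' ⟨b', ha', hb', p', -, hp'⟩ hne
  obtain ⟨q, hq⟩ := hB.exists_walk hG hb hb'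
  refine hA.adj_of_walk ha ha' (p.append (q.append p'.reverse)) (fun x hx hxA => ?_) hne
  simp only [SimpleGraph.Walk.mem_support_append_iff, SimpleGraph.Walk.support_reverse,
    List.mem_reverse] at hx
  rcases hx with hx | hx | hx
  · exact Or.inl ((hp x hx).1 hxA)
  · exact (Set.disjoint_left.1 hAB hxA (hq x hx)).elim
  · exact Or.inr ((hp' x hx).1 hxA)

/-- Imprints do not change when both sets shrink but keep their imprints. -/
lemma imprint_eq_of_subset {A B A' B' : Set V} (hA : A' ⊆ A) (hB : B' ⊆ B)
    (hA' : imprint G A B ⊆ A') (hB' : imprint G B A ⊆ B') :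
    imprint G A' B' = imprint G A B := by
  apply Set.Subset.antisymm
  · rintro a ⟨b, ha, hb, p, hpath, hp⟩
    refine ⟨b, hA ha, hB hb, p, hpath, fun x hx => ⟨fun hxA => ?_, fun hxB => ?_⟩⟩
    -- The part of `p` from `x` to `b` contains mutual imprints of `A` and `B`. The first of them is
    -- in `A'`, so it is `a`; as `p` is a path, it meets `a` at or after `x` only if `x = a`. The
    -- part from `a` to `x` is used in the same way.
    · obtain ⟨q₁, q₂, hq⟩ := SimpleGraph.Walk.mem_support_iff_exists_append.1 hx
      obtain ⟨a₁, b₁, h, ha₁, -⟩ := exists_mutualImprints q₂ hxA (hB hb)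
      have h1 : a₁ = a := (hp a₁ (by
        rw [hq, SimpleGraph.Walk.mem_support_append_iff]; exact Or.inr ha₁)).1 (hA' ⟨b₁, h⟩)
      subst h1
      rw [hq] at hpath
      have hnd := hpath.support_nodup
      rw [SimpleGraph.Walk.support_append, List.nodup_append] at hnd
      rcases q₂.mem_support_iff.1 ha₁ with h2 | h2
      · exact h2.symm
      · exact (hnd.2.2 a₁ q₁.start_mem_support a₁ h2 rfl).elim
    · obtain ⟨q₁, q₂, hq⟩ := SimpleGraph.Walk.mem_support_iff_exists_append.1 hx
      obtain ⟨a₁, b₁, h, -, hb₁⟩ := exists_mutualImprints q₁ (hA ha) hxB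
      have h1 : b₁ = b := (hp b₁ (by
        rw [hq, SimpleGraph.Walk.mem_support_append_iff]; exact Or.inl hb₁)).2
          (hB' h.mem_imprint_right)
      subst h1
      rw [hq] at hpath
      have hnd := hpath.support_nodup
      rw [SimpleGraph.Walk.support_append, List.nodup_append] at hnd
      by_contra hne
      rcases q₂.mem_support_iff.1 q₂.end_mem_support with h2 | h2
      · exact hne h2.symm
      · exact hnd.2.2 b₁ hb₁ b₁ h2 rfl
  · rintro a ⟨b, h⟩
    obtain ⟨ha, hb, p, hpath, hp⟩ := id h
    exact ⟨b, hA' ⟨b, h⟩, hB' h.mem_imprint_right, p, hpath,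
      fun x hx => ⟨fun hxA => (hp x hx).1 (hA hxA), fun hxB => (hp x hx).2 (hB hxB)⟩⟩

/-- A halfspace that separates the imprints separates the sets: a walk outside of `H` from a point
of `A` to the imprint on `B` would contain a point of the imprint on `A`. -/
lemma subset_of_imprint_subset (hG : G.Connected) {A B H : Set V} (hH : Convex G Hᶜ)
    (hB : (imprint G B A).Nonempty) (hA : imprint G A B ⊆ H) (hB' : imprint G B A ⊆ Hᶜ) :
    A ⊆ H := by
  intro x hx
  by_contra hxH
  obtain ⟨b, hb⟩ := hB
  obtain ⟨p, hp⟩ := hH.exists_walk hG hxH (hB' hb)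
  obtain ⟨a₁, b₁, h, ha₁, -⟩ := exists_mutualImprints p hx (imprint_subset _ _ hb)
  exact hp a₁ ha₁ (hA ⟨b₁, h⟩)

/-! ### The compressor -/

lemma compl_mem_halfspaces {H : Set V} (hH : H ∈ halfspaces G) : Hᶜ ∈ halfspaces G :=
  ⟨hH.2, by rw [compl_compl]; exact hH.1⟩

lemma convex_univ : Convex G (Set.univ : Set V) := fun _ _ _ _ _ _ => trivial

lemma convex_empty : Convex G (∅ : Set V) := fun _ h => h.elim

lemma univ_mem_halfspaces : (Set.univ : Set V) ∈ halfspaces G :=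
  ⟨convex_univ, by rw [Set.compl_univ]; exact convex_empty⟩

lemma empty_mem_halfspaces : (∅ : Set V) ∈ halfspaces G :=
  ⟨convex_empty, by rw [Set.compl_empty]; exact convex_univ⟩

/-- Being below the sign vector of `H` means that `H` separates the two labels. -/
lemma below_signVector_iff {X : Sample V} {H : Set V} :
    Below X (signVector H) ↔ pos X ⊆ H ∧ neg X ⊆ Hᶜ := by
  constructor
  · intro h
    refine ⟨fun v (hv : X v = 1) => ?_, fun v (hv : X v = -1) hvH => ?_⟩
    · by_contra hvH
      have := h v
      simp [signVector, hv, hvH] at this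
    · have := h v
      simp [signVector, hv, hvH] at this
  · rintro ⟨h1, h2⟩ v
    rcases hv : X v with _ | _ | _
    · exact Or.inl rfl
    · right
      have : v ∉ H := h2 hv
      simp [signVector, this]
    · right
      have : v ∈ H := h1 hv
      simp [signVector, this]

lemma disjoint_pos_neg (X : Sample V) : Disjoint (pos X) (neg X) :=
  Set.disjoint_left.2 fun v (h1 : X v = 1) (h2 : X v = -1) => by
    rw [h1] at h2; exact absurd h2 (by decide)

lemma pos_subset_of_below {X Y : Sample V} (h : Below X Y) : pos X ⊆ pos Y := by
  intro v (hv : X v = 1)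
  rcases h v with h | h
  · rw [h] at hv; exact absurd hv (by decide)
  · exact h.symm.trans hv

lemma neg_subset_of_below {X Y : Sample V} (h : Below X Y) : neg X ⊆ neg Y := by
  intro v (hv : X v = -1)
  rcases h v with h | h
  · rw [h] at hv; exact absurd hv (by decide)
  · exact h.symm.trans hv

lemma below_of_subset {X Y : Sample V} (h1 : pos X ⊆ pos Y) (h2 : neg X ⊆ neg Y) : Below X Y := by
  intro v
  rcases hv : X v with _ | _ | _
  · exact Or.inl rfl
  · exact Or.inr (h2 hv : Y v = -1).symm
  · exact Or.inr (h1 hv : Y v = 1).symm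

lemma sample_ext {X Y : Sample V} (h1 : pos X = pos Y) (h2 : neg X = neg Y) : X = Y := by
  funext v
  rcases below_of_subset h1.le h2.le v with h | h
  · rcases below_of_subset h1.ge h2.ge v with h' | h'
    · rw [h, h']
    · exact h'.symm
  · exact h

variable {e : V ≃ Fin n}

lemma IsFirstPair.unique {S : Set V} {a x y x' y' : V} (h : IsFirstPair G e S a x y)
    (h' : IsFirstPair G e S a x' y') : x = x' ∧ y = y' := by
  have h1 := le_antisymm (h.2.2.2 x' h'.1 y' h'.2.1 h'.2.2.1) (h'.2.2.2 x h.1 y h.2.1 h.2.2.1)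
  have h2 := Prod.ext_iff.1 (toLex.injective h1)
  exact ⟨e.injective h2.1, e.injective h2.2⟩

lemma exists_isFirstPair {S : Set V} {a : V} (ha : a ∈ hull G S) :
    ∃ x y, IsFirstPair G e S a x y := by
  have : Finite V := Finite.of_equiv _ e.symm
  obtain ⟨x, hx, y, hy, h⟩ := exists_pair_of_mem_hull ha
  obtain ⟨p, hp, hmin⟩ := Set.exists_min_image
    {p : V × V | p.1 ∈ S ∧ p.2 ∈ S ∧ a ∈ hull G {p.1, p.2}}
    (fun p => toLex (e p.1, e p.2)) (Set.toFinite _) ⟨(x, y), hx, hy, h⟩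
  exact ⟨p.1, p.2, hp.1, hp.2.1, hp.2.2, fun x' hx' y' hy' h' => hmin (x', y') ⟨hx', hy', h'⟩⟩

lemma firstPairs_subset (S I : Set V) : firstPairs G e S I ⊆ S := by
  rintro x ⟨a, -, y, z, h, rfl | rfl⟩
  · exact h.1
  · exact h.2.1

lemma subset_hull_firstPairs {S I : Set V} (hI : I ⊆ hull G S) :
    I ⊆ hull G (firstPairs G e S I) := by
  intro a ha
  obtain ⟨x, y, h⟩ := exists_isFirstPair (e := e) (hI ha)
  refine hull_mono (fun z hz => ?_) h.2.2.1
  exact ⟨a, ha, x, y, h, hz⟩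

lemma ncard_firstPairs_le (S I : Set V) : (firstPairs G e S I).ncard ≤ 2 * I.ncard := by
  have : Finite V := Finite.of_equiv _ e.symm
  classical
  -- A point of `I` together with the side on which it is kept determines the kept point.
  have hsub : firstPairs G e S I ⊆ ((fun a => if h : ∃ x y, IsFirstPair G e S a x y
      then h.choose else a) '' I) ∪ ((fun a => if h : ∃ x y, IsFirstPair G e S a x y
      then h.choose_spec.choose else a) '' I) := by
    rintro x ⟨a, ha, y, z, h, hx⟩
    have hex : ∃ x y, IsFirstPair G e S a x y := ⟨y, z, h⟩
    have := h.unique hex.choose_spec.choose_spec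
    rcases hx with rfl | rfl
    · exact Or.inl ⟨a, ha, by simp only [hex, dif_pos]; exact this.1.symm⟩
    · exact Or.inr ⟨a, ha, by simp only [hex, dif_pos]; exact this.2.symm⟩
  calc _ ≤ _ := Set.ncard_le_ncard hsub
    _ ≤ _ := Set.ncard_union_le _ _
    _ ≤ I.ncard + I.ncard := add_le_add (Set.ncard_image_le I.toFinite)
        (Set.ncard_image_le I.toFinite)
    _ = 2 * I.ncard := by ring

/-- Removing points outside of the first pairs does not change which pairs come first. -/
lemma firstPairs_eq_of_subset {S S' I : Set V} (h : S' ⊆ S) (h' : firstPairs G e S I ⊆ S')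
    (hI : I ⊆ hull G S) : firstPairs G e S' I = firstPairs G e S I := by
  have key : ∀ a ∈ I, ∀ x y, IsFirstPair G e S a x y → IsFirstPair G e S' a x y :=
    fun a ha x y hxy => ⟨h' ⟨a, ha, x, y, hxy, Or.inl rfl⟩, h' ⟨a, ha, x, y, hxy, Or.inr rfl⟩,
      hxy.2.2.1, fun x' hx' y' hy' => hxy.2.2.2 x' (h hx') y' (h hy')⟩
  apply Set.Subset.antisymm
  · rintro x ⟨a, ha, y, z, hyz, hx⟩
    obtain ⟨y', z', h1⟩ := exists_isFirstPair (e := e) (hI ha)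
    obtain ⟨rfl, rfl⟩ := hyz.unique (key a ha y' z' h1)
    exact ⟨a, ha, y, z, h1, hx⟩
  · rintro x ⟨a, ha, y, z, hyz, hx⟩
    exact ⟨a, ha, y, z, key a ha y z hyz, hx⟩

lemma firstVertex_subset (S : Set V) : firstVertex e S ⊆ S := fun _ h => h.1

lemma firstVertex_nonempty {S : Set V} (hS : S.Nonempty) : (firstVertex e S).Nonempty := by
  have : Finite V := Finite.of_equiv _ e.symm
  obtain ⟨x, hx, h⟩ := Set.exists_min_image S e S.toFinite hS
  exact ⟨x, hx, h⟩

lemma firstVertex_subsingleton (S : Set V) : (firstVertex e S).Subsingleton :=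
  fun x hx y hy => e.injective (le_antisymm (hx.2 y hy.1) (hy.2 x hx.1))

lemma keptPoints_subset (S T : Set V) : keptPoints G e S T ⊆ S := by
  unfold keptPoints
  split_ifs
  · exact firstVertex_subset S
  · exact firstPairs_subset _ _

lemma keptPoints_empty_left (T : Set V) : keptPoints G e ∅ T = ∅ :=
  Set.subset_empty_iff.1 (keptPoints_subset _ _)

lemma imprint_subset_hull_keptPoints {S T : Set V} (hT : T.Nonempty) :
    imprint G (hull G S) (hull G T) ⊆ hull G (keptPoints G e S T) := by
  rw [keptPoints, if_neg hT.ne_empty]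
  exact subset_hull_firstPairs (imprint_subset _ _)

lemma keptPoints_nonempty (hG : G.Connected) {S T : Set V} (hS : S.Nonempty) :
    (keptPoints G e S T).Nonempty := by
  rcases T.eq_empty_or_nonempty with rfl | hT
  · rw [keptPoints, if_pos rfl]
    exact firstVertex_nonempty hS
  · obtain ⟨a, ha⟩ := imprint_nonempty hG (hS.mono (subset_hull S))
      (hT.mono (subset_hull (G := G) T))
    by_contra h
    have := imprint_subset_hull_keptPoints (e := e) hT ha
    rw [Set.not_nonempty_iff_eq_empty.1 h, hull_empty] at this
    exact this

lemma pos_compressor (X : Sample V) : pos (compressor G e X) = keptPoints G e (pos X) (neg X) := by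
  ext v
  change compressor G e X v = 1 ↔ _
  unfold compressor
  split_ifs with h1 h2 <;> simp [h1]

lemma neg_compressor (X : Sample V) : neg (compressor G e X) = keptPoints G e (neg X) (pos X) := by
  ext v
  change compressor G e X v = -1 ↔ _
  unfold compressor
  split_ifs with h1 h2
  · refine ⟨fun h => absurd h (by decide), fun h => ?_⟩
    exact (Set.disjoint_left.1 (disjoint_pos_neg X) (keptPoints_subset _ _ h1)
      (keptPoints_subset _ _ h)).elim
  · simp [h2]
  · simp [h2]

lemma compressor_below (X : Sample V) : Below (compressor G e X) X :=
  below_of_subset (by rw [pos_compressor]; exact keptPoints_subset _ _)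
    (by rw [neg_compressor]; exact keptPoints_subset _ _)

lemma hull_disjoint {S T H : Set V} (hH : H ∈ halfspaces G) (hS : S ⊆ H) (hT : T ⊆ Hᶜ) :
    Disjoint (hull G S) (hull G T) :=
  Set.disjoint_left.2 fun _ h1 h2 => hull_subset hH.2 hT h2 (hull_subset hH.1 hS h1)

lemma ncard_keptPoints_le (hG : G.Connected) {S T H : Set V} (hH : H ∈ halfspaces G) (hS : S ⊆ H)
    (hT : T ⊆ Hᶜ) : (keptPoints G e S T).ncard ≤ 2 * G.cliqueNum := by
  have : Finite V := Finite.of_equiv _ e.symm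
  have hcl : ∀ K : Set V, G.IsClique K → K.ncard ≤ G.cliqueNum := by
    intro K hK
    rw [Set.ncard_eq_toFinset_card K K.toFinite]
    exact SimpleGraph.IsClique.card_le_cliqueNum (t := K.toFinite.toFinset)
      (tc := by simpa using hK)
  rcases T.eq_empty_or_nonempty with rfl | hne
  · obtain ⟨v⟩ := hG.nonempty
    have h1 := hcl {v} (by simp)
    rw [Set.ncard_singleton] at h1
    rw [keptPoints, if_pos rfl]
    have := Set.ncard_le_one_iff_subsingleton.2 (firstVertex_subsingleton (e := e) S)
    omega
  · rw [keptPoints, if_neg hne.ne_empty]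
    exact (ncard_firstPairs_le _ _).trans (Nat.mul_le_mul_left 2 (hcl _
      (isClique_imprint hG (convex_hull S) (convex_hull T) (hull_disjoint hH hS hT))))

lemma supp_eq (X : Sample V) : supp X = pos X ∪ neg X := by
  ext v
  change X v ≠ 0 ↔ X v = 1 ∨ X v = -1
  rcases X v with _ | _ | _ <;> decide

/-- The imprints of the hulls survive when points are removed that the compressor drops. -/
lemma imprint_hull_eq {S S' T T' : Set V} (hS : S' ⊆ S) (hT : T' ⊆ T)
    (hS' : keptPoints G e S T ⊆ S') (hT' : keptPoints G e T S ⊆ T') (hSn : S.Nonempty)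
    (hTn : T.Nonempty) :
    imprint G (hull G S') (hull G T') = imprint G (hull G S) (hull G T) :=
  imprint_eq_of_subset (hull_mono hS) (hull_mono hT)
    ((imprint_subset_hull_keptPoints hTn).trans (hull_mono hS'))
    ((imprint_subset_hull_keptPoints hSn).trans (hull_mono hT'))

lemma keptPoints_eq (hG : G.Connected) {S S' T T' : Set V} (hS : S' ⊆ S) (hT : T' ⊆ T)
    (hS' : keptPoints G e S T ⊆ S') (hT' : keptPoints G e T S ⊆ T') :
    keptPoints G e S' T' = keptPoints G e S T := by
  rcases S.eq_empty_or_nonempty with rfl | hSn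
  · rw [Set.subset_empty_iff.1 hS, keptPoints_empty_left, keptPoints_empty_left]
  rcases T.eq_empty_or_nonempty with rfl | hTn
  · rw [Set.subset_empty_iff.1 hT]
    rw [keptPoints, if_pos rfl] at hS' ⊢
    rw [keptPoints, if_pos rfl]
    obtain ⟨x, hx⟩ := firstVertex_nonempty (e := e) hSn
    have hx' : x ∈ firstVertex e S' := ⟨hS' hx, fun y hy => hx.2 y (hS hy)⟩
    rw [(firstVertex_subsingleton S').eq_singleton_of_mem hx',
      (firstVertex_subsingleton S).eq_singleton_of_mem hx]
  · have h1 := imprint_hull_eq hS hT hS' hT' hSn hTn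
    have hT'n : T'.Nonempty := (keptPoints_nonempty hG hTn).mono hT'
    rw [keptPoints, if_neg hT'n.ne_empty, h1]
    rw [keptPoints, if_neg hTn.ne_empty] at hS' ⊢
    exact firstPairs_eq_of_subset hS hS' (imprint_subset _ _)

lemma compressor_eq (hG : G.Connected) {X X' : Sample V} (h : Below (compressor G e X) X')
    (h' : Below X' X) : compressor G e X' = compressor G e X := by
  have h1 := pos_subset_of_below h
  have h2 := neg_subset_of_below h
  rw [pos_compressor] at h1
  rw [neg_compressor] at h2
  apply sample_ext
  · rw [pos_compressor, pos_compressor,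
      keptPoints_eq hG (pos_subset_of_below h') (neg_subset_of_below h') h1 h2]
  · rw [neg_compressor, neg_compressor,
      keptPoints_eq hG (neg_subset_of_below h') (pos_subset_of_below h') h2 h1]

/-- A halfspace that separates the imprints for the compressed sample is consistent with the
sample. -/
lemma IsReconstructor.below (hG : G.Connected) {β : Sample V → Set V}
    (hβ : IsReconstructor G e β) {X : Sample V} (hX : X ∈ realizable (halfspaces G)) :
    Below X (signVector (β (compressor G e X))) := by
  obtain ⟨hH, h1, h2, h3, h4⟩ := hβ _ ⟨X, hX, rfl⟩
  set H := β (compressor G e X)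
  rw [pos_compressor, neg_compressor] at h1 h2
  rw [pos_compressor, neg_compressor] at h3 h4
  rw [below_signVector_iff]
  rcases (pos X).eq_empty_or_nonempty with hp | hp
  · refine ⟨hp ▸ Set.empty_subset _, ?_⟩
    rcases (neg X).eq_empty_or_nonempty with hn | hn
    · exact hn ▸ Set.empty_subset _
    · rw [h4 (keptPoints_nonempty hG hn) (by rw [hp, keptPoints_empty_left])]
      simp
  · rcases (neg X).eq_empty_or_nonempty with hn | hn
    · refine ⟨?_, hn ▸ Set.empty_subset _⟩
      rw [h3 (keptPoints_nonempty hG hp) (by rw [hn, keptPoints_empty_left])]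
      exact Set.subset_univ _
    · rw [imprint_hull_eq (keptPoints_subset _ _) (keptPoints_subset _ _) le_rfl le_rfl hp hn] at h1
      rw [imprint_hull_eq (keptPoints_subset _ _) (keptPoints_subset _ _) le_rfl le_rfl hn hp] at h2
      have hi := imprint_nonempty hG (hp.mono (subset_hull (G := G) _))
        (hn.mono (subset_hull (G := G) _))
      have hi' := imprint_nonempty hG (hn.mono (subset_hull (G := G) _))
        (hp.mono (subset_hull (G := G) _))
      exact ⟨(subset_hull _).trans (subset_of_imprint_subset hG hH.2 hi' h1 h2),
        (subset_hull _).trans (subset_of_imprint_subset hG (by rw [compl_compl]; exact hH.1) hi h2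
          (by rw [compl_compl]; exact h1))⟩

lemma IsReconstructor.isLSCS (hG : G.Connected) {β : Sample V → Set V}
    (hβ : IsReconstructor G e β) :
    IsLSCS (halfspaces G) (compressor G e) β (4 * G.cliqueNum) := by
  intro X hX
  refine ⟨compressor_below X, hβ.below hG hX, ?_⟩
  obtain ⟨H, hH, hXH⟩ := hX
  rw [below_signVector_iff] at hXH
  rw [supp_eq, pos_compressor, neg_compressor]
  have h1 := ncard_keptPoints_le (e := e) hG hH hXH.1 hXH.2
  have h2 := ncard_keptPoints_le (e := e) hG (compl_mem_halfspaces hH) hXH.2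
    (T := pos X) (by rw [compl_compl]; exact hXH.1)
  have h3 := Set.ncard_union_le (keptPoints G e (pos X) (neg X)) (keptPoints G e (neg X) (pos X))
  omega

lemma IsReconstructor.isProper {β : Sample V → Set V} (hβ : IsReconstructor G e β) :
    IsProper (halfspaces G) (compressor G e) β := fun X hX => (hβ _ ⟨X, hX, rfl⟩).1

lemma isStable_compressor (hG : G.Connected) (β : Sample V → Set V) :
    IsStable (halfspaces G) (compressor G e) β := fun _ _ _ h h' => by rw [compressor_eq hG h h']

end Monophonic

/-! ### Running programs -/

namespace RAM

open Compression

/-- Started in `s`, the program `P` halts within `t` steps in a store that satisfies `Q`. -/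
def Halts (P : Program) (s : Store) (t : ℕ) (Q : Store → Prop) : Prop :=
  ∃ t' ≤ t, ∃ s', Runs P s t' s' ∧ Q s'

lemma Halts.imp {P : Program} {s : Store} {t t' : ℕ} {Q Q' : Store → Prop} (h : Halts P s t Q)
    (ht : t ≤ t') (hQ : ∀ s', Q s' → Q' s') : Halts P s t' Q' := by
  obtain ⟨t₁, h1, s', h2, h3⟩ := h
  exact ⟨t₁, h1.trans ht, s', h2, hQ _ h3⟩

lemma Halts.skip {s : Store} {Q : Store → Prop} (h : Q s) : Halts .skip s 1 Q :=
  ⟨1, le_rfl, s, .skip s, h⟩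

lemma Halts.assign {s : Store} {x : ℕ} {E : Expr} {Q : Store → Prop}
    (h : Q (s.setReg x (E.eval s))) : Halts (.assign x E) s (E.cost + 1) Q :=
  ⟨_, le_rfl, _, .assign s x E, h⟩

lemma Halts.write {s : Store} {a : ℕ} {i j E : Expr} {Q : Store → Prop}
    (h : Q (s.setArr a (i.eval s) (j.eval s) (E.eval s))) :
    Halts (.write a i j E) s (i.cost + j.cost + E.cost + 1) Q :=
  ⟨_, le_rfl, _, .write s a i j E, h⟩

lemma Halts.seq {P P' : Program} {s : Store} {t t' : ℕ} {R Q : Store → Prop}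
    (h : Halts P s t R) (h' : ∀ s', R s' → Halts P' s' t' Q) : Halts (.seq P P') s (t + t') Q := by
  obtain ⟨t₁, h1, s₁, h2, h3⟩ := h
  obtain ⟨t₂, h4, s₂, h5, h6⟩ := h' _ h3
  exact ⟨_, add_le_add h1 h4, s₂, .seq h2 h5, h6⟩

lemma Halts.ite {P P' : Program} {b : Expr} {s : Store} {t t' : ℕ} {Q : Store → Prop}
    (h : b.eval s ≠ 0 → Halts P s t Q) (h' : b.eval s = 0 → Halts P' s t' Q) :
    Halts (.ite b P P') s (b.cost + 1 + (t + t')) Q := by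
  by_cases hb : b.eval s = 0
  · obtain ⟨t₁, h1, s₁, h2, h3⟩ := h' hb
    exact ⟨_, by omega, s₁, .ite_false hb h2, h3⟩
  · obtain ⟨t₁, h1, s₁, h2, h3⟩ := h hb
    exact ⟨_, by omega, s₁, .ite_true hb h2, h3⟩

/-- The program that runs `P` for the values `0, …, n - 1` of the register `x`, where `n` is the
content of register `0`. -/
def forLoop (x : ℕ) (P : Program) : Program :=
  .seq (.assign x (.const 0))
    (.loop (.sub (.reg 0) (.reg x)) (.seq P (.assign x (.add (.reg x) (.const 1)))))

lemma Halts.forLoop {x n T : ℕ} {P : Program} {s : Store} (Inv : ℕ → Store → Prop)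
    (h0 : Inv 0 (s.setReg x 0)) (hreg : ∀ i s', Inv i s' → s'.reg 0 = n ∧ s'.reg x = i)
    (hstep : ∀ i s', i < n → Inv i s' →
      Halts P s' T fun s'' => s''.reg x = i ∧ Inv (i + 1) (s''.setReg x (i + 1))) :
    Halts (forLoop x P) s (n * (T + 8) + 6) (Inv n) := by
  have key : ∀ k i s', i + k = n → Inv i s' →
      Halts (.loop (.sub (.reg 0) (.reg x)) (.seq P (.assign x (.add (.reg x) (.const 1))))) s'
        (k * (T + 8) + 4) (Inv n) := by
    intro k
    induction k with
    | zero =>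
      intro i s' hi hinv
      obtain rfl : i = n := by omega
      obtain ⟨h1, h2⟩ := hreg _ _ hinv
      exact ⟨_, by simp [Expr.cost], s', Runs.loop_stop (by simp [Expr.eval, h1, h2]), hinv⟩
    | succ k ih =>
      intro i s' hi hinv
      obtain ⟨h1, h2⟩ := hreg _ _ hinv
      obtain ⟨t₁, ht₁, s₁, hr₁, hx, hinv₁⟩ := hstep i s' (by omega) hinv
      obtain ⟨t₂, ht₂, s₂, hr₂, hinv₂⟩ := ih (i + 1) _ (by omega) hinv₁
      have hr : Runs (.seq P (.assign x (.add (.reg x) (.const 1)))) s' (t₁ + 4)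
          (s₁.setReg x (i + 1)) := by
        have := Runs.seq hr₁ (.assign s₁ x (.add (.reg x) (.const 1)))
        simpa [Expr.eval, Expr.cost, hx] using this
      refine ⟨_, ?_, s₂, .loop_step (by simp only [Expr.eval, h1, h2]; omega) hr hr₂, hinv₂⟩
      simp only [Expr.cost]
      nlinarith
  obtain ⟨t₁, ht₁, s₁, hr₁, hinv₁⟩ := key n 0 _ (by omega) h0
  refine ⟨_, ?_, s₁, .seq (.assign s x (.const 0)) hr₁, hinv₁⟩
  simp only [Expr.cost]
  omega

/-! ### Queries in polynomial time -/

/-- The truth value of a proposition as a number. -/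
noncomputable def bit (p : Prop) : ℕ := by classical exact if p then 1 else 0

lemma bit_of {p : Prop} (h : p) : bit p = 1 := by simp [bit, h]

lemma bit_of_not {p : Prop} (h : ¬ p) : bit p = 0 := by simp [bit, h]

lemma bit_eq_zero {p : Prop} : bit p = 0 ↔ ¬ p := by
  by_cases h : p <;> simp [bit, h]

lemma bit_congr {p q : Prop} (h : p ↔ q) : bit p = bit q := by rw [propext h]

/-- The data that a program receives: a labeled graph and a sample. -/
structure Input : Type (u + 1) where
  /-- the vertices -/
  V : Type u
  /-- the number of vertices -/
  n : ℕ
  /-- the graph -/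
  G : SimpleGraph V
  /-- the labeling of the vertices -/
  e : V ≃ Fin n
  /-- the sample -/
  X : Sample V

/-- Two stores agree on the registers below `d`, except for the result register `1`, and on the
arrays below `m`. -/
def Agree (d m : ℕ) (s s' : Store) : Prop :=
  (∀ x < d, x ≠ 1 → s'.reg x = s.reg x) ∧ ∀ a < m, s'.arr a = s.arr a

lemma Agree.refl (d m : ℕ) (s : Store) : Agree d m s s := ⟨fun _ _ _ => rfl, fun _ _ => rfl⟩

lemma Agree.trans {d m : ℕ} {s s' s'' : Store} (h : Agree d m s s') (h' : Agree d m s' s'') :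
    Agree d m s s'' :=
  ⟨fun x hx hx' => (h'.1 x hx hx').trans (h.1 x hx hx'), fun a ha => (h'.2 a ha).trans (h.2 a ha)⟩

lemma Agree.mono {d m d' m' : ℕ} {s s' : Store} (h : Agree d m s s') (hd : d' ≤ d) (hm : m' ≤ m) :
    Agree d' m' s s' :=
  ⟨fun x hx hx' => h.1 x (hx.trans_le hd) hx', fun a ha => h.2 a (ha.trans_le hm)⟩

lemma Agree.setReg {d m : ℕ} {s s' : Store} (h : Agree d m s s') {x c : ℕ} (hx : d ≤ x ∨ x = 1) :
    Agree d m s (s'.setReg x c) := by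
  refine ⟨fun y hy hy' => ?_, fun a ha => h.2 a ha⟩
  have hne : y ≠ x := by omega
  simp only [Store.setReg, Function.update_of_ne hne]
  exact h.1 y hy hy'

lemma Agree.setArr {d m : ℕ} {s s' : Store} (h : Agree d m s s') {a i j c : ℕ} (ha : m ≤ a) :
    Agree d m s (s'.setArr a i j c) := by
  refine ⟨h.1, fun b hb => ?_⟩
  have hne : b ≠ a := by omega
  rw [← h.2 b hb]
  funext i' j'
  simp [Store.setArr, hne]

/-- A context: for every input, a type of values, together with their representation in the
store of the machine. The representation only uses the registers below `d` (but not the result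
register `1`) and the arrays below `m`, so that a program may use all others as work space. -/
structure Ctx : Type (u + 1) where
  /-- the values -/
  T : Input.{u} → Type u
  /-- the store represents a value -/
  rep : ∀ I, T I → Store → Prop
  /-- bound for the registers in use -/
  d : ℕ
  /-- bound for the arrays in use -/
  m : ℕ
  /-- registers `0` and `1` have fixed roles -/
  two_le : 2 ≤ d
  /-- the representation survives changes of the work space -/
  frame : ∀ {I γ s s'}, rep I γ s → Agree d m s s' → rep I γ s'
  /-- the input is still present -/
  input : ∀ {I γ s}, rep I γ s → s.reg 0 = I.n ∧
    ∀ a < 2, s.arr a = (inputStore I.G I.e I.X).arr a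

/-- The context without any value besides the input. -/
def Ctx.base : Ctx.{u} where
  T _ := PUnit
  rep I _ s := s.reg 0 = I.n ∧ ∀ a < 2, s.arr a = (inputStore I.G I.e I.X).arr a
  d := 2
  m := 3
  two_le := le_rfl
  frame h h' := ⟨(h'.1 0 (by omega) (by omega)).trans h.1,
    fun a ha => (h'.2 a (by omega)).trans (h.2 a ha)⟩
  input h := h

/-- The context extended by a vertex, in register `d`. Register `d + 1` is reserved. -/
def Ctx.elem (Γ : Ctx.{u}) : Ctx.{u} where
  T I := Γ.T I × I.V
  rep I γ s := Γ.rep I γ.1 s ∧ s.reg Γ.d = I.e γ.2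
  d := Γ.d + 2
  m := Γ.m
  two_le := by omega
  frame h h' := ⟨Γ.frame h.1 (h'.mono (by omega) le_rfl),
    (h'.1 _ (by omega) (by have := Γ.two_le; omega)).trans h.2⟩
  input h := Γ.input h.1

/-- The context extended by a set of signed vertices, in the columns `0` and `1` of the array `m`.
Register `d` and array `m + 1` are reserved. -/
def Ctx.set (Γ : Ctx.{u}) : Ctx.{u} where
  T I := Γ.T I × Set (I.V × Bool)
  rep I γ s := Γ.rep I γ.1 s ∧
    ∀ v c, s.arr Γ.m (I.e v) (Bool.toNat c) = bit ((v, c) ∈ γ.2)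
  d := Γ.d + 1
  m := Γ.m + 2
  two_le := by have := Γ.two_le; omega
  frame h h' := ⟨Γ.frame h.1 (h'.mono (by omega) (by omega)),
    fun v c => by rw [h'.2 _ (by omega)]; exact h.2 v c⟩
  input h := Γ.input h.1

/-- The property `φ` of the values of a context is decided in polynomial time: some program
writes its truth value to register `1`. -/
def Comp (Γ : Ctx.{u}) (φ : ∀ I, Γ.T I → Prop) : Prop :=
  ∃ (P : Program) (p : Polynomial ℕ), ∀ I γ s, Γ.rep I γ s →
    Halts P s (p.eval I.n) fun s' => Agree Γ.d Γ.m s s' ∧ s'.reg 1 = bit (φ I γ)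

/-- The vertex `f` is the content of a register. -/
def Var (Γ : Ctx.{u}) (f : ∀ I, Γ.T I → I.V) : Prop :=
  ∃ x, ∀ I γ s, Γ.rep I γ s → s.reg x = I.e (f I γ)

/-- The context `Γ'` extends `Γ` along `π`: its values determine values of `Γ` with the same
representation. -/
def Ext (Γ Γ' : Ctx.{u}) (π : ∀ I, Γ'.T I → Γ.T I) : Prop :=
  ∀ I γ s, Γ'.rep I γ s → Γ.rep I (π I γ) s

/-- Membership in the set `S` is decided in polynomial time in every extension of the context. The
extensions are part of the definition so that `S` can be used below further quantifiers and fixed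
points, where more registers and arrays are in use. -/
def CSet (Γ : Ctx.{u}) (S : ∀ I, Γ.T I → Set I.V) : Prop :=
  ∀ (Γ' : Ctx.{u}) (π : ∀ I, Γ'.T I → Γ.T I), Ext Γ Γ' π → ∀ f, Var Γ' f →
    Comp Γ' fun I γ => f I γ ∈ S I (π I γ)

/-- Membership in the set `L` of signed vertices is decided in polynomial time in every extension
of the context. -/
def CLit (Γ : Ctx.{u}) (L : ∀ I, Γ.T I → Set (I.V × Bool)) : Prop :=
  ∀ (Γ' : Ctx.{u}) (π : ∀ I, Γ'.T I → Γ.T I), Ext Γ Γ' π → ∀ f, Var Γ' f → ∀ c : Bool,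
    Comp Γ' fun I γ => (f I γ, c) ∈ L I (π I γ)

variable {Γ Γ' : Ctx.{u}} {φ ψ : ∀ I, Γ.T I → Prop} {f g : ∀ I, Γ.T I → I.V}
  {π : ∀ I, Γ'.T I → Γ.T I}

lemma Ext.refl (Γ : Ctx.{u}) : Ext Γ Γ fun _ γ => γ := fun _ _ _ h => h

lemma Ext.elem (Γ : Ctx.{u}) : Ext Γ Γ.elem fun _ γ => γ.1 := fun _ _ _ h => h.1

lemma Ext.set (Γ : Ctx.{u}) : Ext Γ Γ.set fun _ γ => γ.1 := fun _ _ _ h => h.1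

lemma Var.ext (hf : Var Γ f) (h : Ext Γ Γ' π) : Var Γ' fun I γ => f I (π I γ) := by
  obtain ⟨x, hx⟩ := hf
  exact ⟨x, fun I γ s hs => hx I _ s (h I γ s hs)⟩

lemma Var.last (Γ : Ctx.{u}) : Var Γ.elem fun _ γ => γ.2 := ⟨Γ.d, fun _ _ _ h => h.2⟩

lemma Var.up (hf : Var Γ f) : Var Γ.elem fun I γ => f I γ.1 := hf.ext (Ext.elem Γ)

lemma CSet.ext {S : ∀ I, Γ.T I → Set I.V} (hS : CSet Γ S) (h : Ext Γ Γ' π) :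
    CSet Γ' fun I γ => S I (π I γ) :=
  fun Γ'' π' h' => hS Γ'' (fun I γ => π I (π' I γ)) fun I γ s hs => h I _ s (h' I γ s hs)

lemma CSet.up {S : ∀ I, Γ.T I → Set I.V} (hS : CSet Γ S) :
    CSet Γ.elem fun I γ => S I γ.1 := hS.ext (Ext.elem Γ)

lemma CSet.mem {S : ∀ I, Γ.T I → Set I.V} (hS : CSet Γ S) (hf : Var Γ f) :
    Comp Γ fun I γ => f I γ ∈ S I γ := hS Γ _ (Ext.refl Γ) f hf

lemma CLit.ext {L : ∀ I, Γ.T I → Set (I.V × Bool)} (hL : CLit Γ L) (h : Ext Γ Γ' π) :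
    CLit Γ' fun I γ => L I (π I γ) :=
  fun Γ'' π' h' => hL Γ'' (fun I γ => π I (π' I γ)) fun I γ s hs => h I _ s (h' I γ s hs)

lemma CLit.up {L : ∀ I, Γ.T I → Set (I.V × Bool)} (hL : CLit Γ L) :
    CLit Γ.elem fun I γ => L I γ.1 := hL.ext (Ext.elem Γ)

lemma CLit.upSet {L : ∀ I, Γ.T I → Set (I.V × Bool)} (hL : CLit Γ L) :
    CLit Γ.set fun I γ => L I γ.1 := hL.ext (Ext.set Γ)

lemma CLit.mem {L : ∀ I, Γ.T I → Set (I.V × Bool)} (hL : CLit Γ L) (hf : Var Γ f) (c : Bool) :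
    Comp Γ fun I γ => (f I γ, c) ∈ L I γ := hL Γ _ (Ext.refl Γ) f hf c

lemma Comp.congr (h : Comp Γ φ) (hφ : ∀ I γ, φ I γ ↔ ψ I γ) : Comp Γ ψ := by
  have : φ = ψ := by funext I γ; exact propext (hφ I γ)
  exact this ▸ h

lemma Comp.of_expr (E : Expr) (h : ∀ I γ s, Γ.rep I γ s → E.eval s = bit (φ I γ)) : Comp Γ φ := by
  refine ⟨.assign 1 E, Polynomial.C (E.cost + 1), fun I γ s hs => ?_⟩
  rw [Polynomial.eval_C]
  refine Halts.assign ⟨(Agree.refl _ _ s).setReg (Or.inr rfl), ?_⟩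
  simp [Store.setReg, h I γ s hs]

lemma CLit.last (Γ : Ctx.{u}) : CLit Γ.set fun _ γ => γ.2 := by
  rintro Γ' π h f ⟨x, hx⟩ c
  refine Comp.of_expr (.read Γ.m (.reg x) (.const c.toNat)) fun I γ s hs => ?_
  simp only [Expr.eval, hx I γ s hs]
  exact (h I γ s hs).2 _ c

lemma inputStore_adj (I : Input.{u}) (v w : I.V) :
    (inputStore I.G I.e I.X).arr 0 (I.e v) (I.e w) = bit (I.G.Adj v w) := by
  simp only [inputStore, bit]
  rw [dif_pos ⟨(I.e v).2, (I.e w).2, trivial⟩]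
  split_ifs <;> simp_all

lemma Comp.adj (hf : Var Γ f) (hg : Var Γ g) : Comp Γ fun I γ => I.G.Adj (f I γ) (g I γ) := by
  obtain ⟨x, hx⟩ := hf
  obtain ⟨y, hy⟩ := hg
  refine Comp.of_expr (.read 0 (.reg x) (.reg y)) fun I γ s hs => ?_
  simp only [Expr.eval, hx I γ s hs, hy I γ s hs, (Γ.input hs).2 0 (by omega), inputStore_adj]

lemma Comp.le (hf : Var Γ f) (hg : Var Γ g) : Comp Γ fun I γ => I.e (f I γ) ≤ I.e (g I γ) := by
  obtain ⟨x, hx⟩ := hf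
  obtain ⟨y, hy⟩ := hg
  refine Comp.of_expr (.sub (.const 1) (.sub (.reg x) (.reg y))) fun I γ s hs => ?_
  simp only [Expr.eval, hx I γ s hs, hy I γ s hs, bit, ← Fin.val_fin_le]
  split_ifs <;> omega

lemma CSet.pos (Γ : Ctx.{u}) : CSet Γ fun I _ => pos I.X := by
  rintro Γ' π - f ⟨x, hx⟩
  refine Comp.of_expr (.sub (.read 1 (.reg x) (.const 0))
    (.sub (.add (.read 1 (.reg x) (.const 0)) (.read 1 (.reg x) (.const 0))) (.const 2)))
    fun I γ s hs => ?_
  have h1 : s.arr 1 (I.e (f I γ)) 0 = labelCode (I.X (f I γ)) := by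
    rw [(Γ'.input hs).2 1 (by omega)]; simp [inputStore]
  have h2 : f I γ ∈ Compression.pos I.X ↔ I.X (f I γ) = 1 := Iff.rfl
  simp only [Expr.eval, hx I γ s hs, h1, bit_congr h2]
  rcases I.X (f I γ) with _ | _ | _ <;> simp [bit, labelCode]

lemma CSet.neg (Γ : Ctx.{u}) : CSet Γ fun I _ => neg I.X := by
  rintro Γ' π - f ⟨x, hx⟩
  refine Comp.of_expr (.sub (.read 1 (.reg x) (.const 0)) (.const 1)) fun I γ s hs => ?_
  have h1 : s.arr 1 (I.e (f I γ)) 0 = labelCode (I.X (f I γ)) := by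
    rw [(Γ'.input hs).2 1 (by omega)]; simp [inputStore]
  have h2 : f I γ ∈ Compression.neg I.X ↔ I.X (f I γ) = -1 := Iff.rfl
  simp only [Expr.eval, hx I γ s hs, h1, bit_congr h2]
  rcases I.X (f I γ) with _ | _ | _ <;> simp [bit, labelCode]

lemma Comp.not (h : Comp Γ φ) : Comp Γ fun I γ => ¬ φ I γ := by
  obtain ⟨P, p, hP⟩ := h
  refine ⟨.seq P (.assign 1 (.sub (.const 1) (.reg 1))), p + 4, fun I γ s hs => ?_⟩
  refine Halts.imp ((hP I γ s hs).seq (t' := 4) fun s' h => Halts.assign (Q := fun s' =>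
    Agree Γ.d Γ.m s s' ∧ s'.reg 1 = bit (¬ φ I γ)) ⟨h.1.setReg (Or.inr rfl), ?_⟩) (by simp)
    fun _ h => h
  simp only [Store.setReg, Expr.eval, Function.update_self, h.2, bit]
  split_ifs <;> simp_all

lemma Comp.and (h : Comp Γ φ) (h' : Comp Γ ψ) : Comp Γ fun I γ => φ I γ ∧ ψ I γ := by
  obtain ⟨P, p, hP⟩ := h
  obtain ⟨P', p', hP'⟩ := h'
  refine ⟨.seq P (.ite (.reg 1) P' .skip), p + (2 + (p' + 1)), fun I γ s hs => ?_⟩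
  refine Halts.imp ((hP I γ s hs).seq fun s' h => Halts.ite (Q := fun s' =>
    Agree Γ.d Γ.m s s' ∧ s'.reg 1 = bit (φ I γ ∧ ψ I γ)) (fun hb => ?_) fun hb => ?_)
    (t := p.eval I.n + (2 + (p'.eval I.n + 1))) (by simp) fun _ h => h
  · have hφ : φ I γ := by simpa [Expr.eval, h.2, bit_eq_zero] using hb
    refine (hP' I γ s' (Γ.frame hs h.1)).imp le_rfl fun s'' h' => ⟨h.1.trans h'.1, ?_⟩
    rw [h'.2]
    exact bit_congr (by simp [hφ])
  · have hφ : ¬ φ I γ := by simpa [Expr.eval, h.2, bit_eq_zero] using hb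
    exact Halts.skip ⟨h.1, by rw [h.2]; exact bit_congr (by simp [hφ])⟩

lemma Comp.or (h : Comp Γ φ) (h' : Comp Γ ψ) : Comp Γ fun I γ => φ I γ ∨ ψ I γ :=
  (h.not.and h'.not).not.congr fun _ _ => by tauto

lemma Comp.imp (h : Comp Γ φ) (h' : Comp Γ ψ) : Comp Γ fun I γ => φ I γ → ψ I γ :=
  (h.and h'.not).not.congr fun _ _ => by tauto

lemma Comp.iff (h : Comp Γ φ) (h' : Comp Γ ψ) : Comp Γ fun I γ => φ I γ ↔ ψ I γ :=
  ((h.imp h').and (h'.imp h)).congr fun _ _ => by tauto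

lemma Comp.eq (hf : Var Γ f) (hg : Var Γ g) : Comp Γ fun I γ => f I γ = g I γ :=
  ((Comp.le hf hg).and (Comp.le hg hf)).congr fun I γ => by
    rw [← le_antisymm_iff, I.e.apply_eq_iff_eq]

/-- An existential quantifier is a loop over the vertices that records in register `d + 1` whether a
witness has been found. -/
lemma Comp.ex {φ : ∀ I, Γ.T I → I.V → Prop} (h : Comp Γ.elem fun I γ => φ I γ.1 γ.2) :
    Comp Γ fun I γ => ∃ v, φ I γ v := by
  obtain ⟨P, p, hP⟩ := h
  have hd := Γ.two_le
  refine ⟨.seq (.assign (Γ.d + 1) (.const 0)) (.seq (forLoop Γ.d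
    (.seq P (.ite (.reg 1) (.assign (Γ.d + 1) (.const 1)) .skip))) (.assign 1 (.reg (Γ.d + 1)))),
    2 + ((Polynomial.X * (p + (2 + (2 + 1)) + 8) + 6) + 2), fun I γ s hs => ?_⟩
  refine Halts.imp (Halts.seq (t := 2) (Halts.assign (Q := fun s' =>
    Agree Γ.d Γ.m s s' ∧ s'.reg (Γ.d + 1) = 0) ⟨(Agree.refl _ _ s).setReg (by omega), ?_⟩)
    fun s₁ h₁ => Halts.seq (Halts.forLoop (x := Γ.d) (n := I.n)
      (T := p.eval I.n + (2 + (2 + 1)))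
      (fun i s' => Agree Γ.d Γ.m s s' ∧ s'.reg Γ.d = i ∧
        s'.reg (Γ.d + 1) = bit (∃ v, I.e v < i ∧ φ I γ v))
      ⟨h₁.1.setReg (by omega), ?_, ?_⟩ ?_ ?_) (t' := 2) fun s₂ h₂ => Halts.assign
        ⟨h₂.1.setReg (Or.inr rfl), ?_⟩) ?_ fun _ h => h
  · simp [Store.setReg, Expr.eval]
  · simp [Store.setReg]
  · simp [Store.setReg, h₁.2, bit]
  · exact fun i s' h => ⟨(Γ.input (Γ.frame hs h.1)).1, h.2.1⟩
  · rintro i s' hi ⟨h1, h2, h3⟩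
    set w := I.e.symm ⟨i, hi⟩ with hw
    have hwi : (I.e w : ℕ) = i := by simp [hw]
    have hlt : ∀ v, (I.e v : ℕ) < i + 1 ↔ (I.e v : ℕ) < i ∨ v = w := by
      intro v
      rw [Nat.lt_succ_iff_lt_or_eq, ← hwi, Fin.val_inj, I.e.apply_eq_iff_eq]
    have hex : (∃ v, (I.e v : ℕ) < i + 1 ∧ φ I γ v) ↔
        (∃ v, (I.e v : ℕ) < i ∧ φ I γ v) ∨ φ I γ w := by
      simp only [hlt, or_and_right, exists_or, exists_eq_left]
    refine (hP I (γ, w) s' ⟨Γ.frame hs h1, by rw [h2, hwi]⟩).seq fun s₂ h₂ => Halts.ite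
      (fun hb => Halts.assign ⟨?_, ((h1.trans (h₂.1.mono (by simp [Ctx.elem]) le_rfl)).setReg
        (by omega)).setReg (by omega), ?_, ?_⟩) fun hb => Halts.skip ⟨?_, (h1.trans
        (h₂.1.mono (by simp [Ctx.elem]) le_rfl)).setReg (by omega), ?_, ?_⟩
    · simp only [Store.setReg]
      rw [Function.update_of_ne (by omega), h₂.1.1 Γ.d (by simp [Ctx.elem]) (by omega), h2]
    · simp [Store.setReg]
    · have hφ : φ I γ w := by simpa [Expr.eval, h₂.2, bit_eq_zero] using hb
      rw [bit_of (hex.2 (Or.inr hφ))]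
      simp [Store.setReg, Expr.eval]
    · rw [h₂.1.1 Γ.d (by simp [Ctx.elem]) (by omega), h2]
    · simp [Store.setReg]
    · have hφ : ¬ φ I γ w := by simpa [Expr.eval, h₂.2, bit_eq_zero] using hb
      simp only [Store.setReg]
      rw [Function.update_of_ne (by omega), h₂.1.1 _ (by simp [Ctx.elem]) (by omega), h3]
      exact bit_congr (by rw [hex]; simp [hφ])
  · simp
  · simp only [Store.setReg, Expr.eval, Function.update_self, h₂.2.2]
    exact bit_congr (by simp)

lemma Comp.all {φ : ∀ I, Γ.T I → I.V → Prop} (h : Comp Γ.elem fun I γ => φ I γ.1 γ.2) :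
    Comp Γ fun I γ => ∀ v, φ I γ v :=
  (Comp.ex (φ := fun I γ v => ¬ φ I γ v) h.not).not.congr fun _ _ => by simp

end RAM

/-! ### Iteration of definable operators -/

lemma Set.ncard_le_iterate_or_isFixed {α : Type*} [Finite α] {F : Set α → Set α} {S : Set α}
    (h : ∀ k, F^[k] S ⊆ F^[k + 1] S) (k : ℕ) :
    k ≤ (F^[k] S).ncard ∨ F (F^[k] S) = F^[k] S := by
  induction k with
  | zero => exact Or.inl (Nat.zero_le _)
  | succ k ih =>
    by_cases hk : F (F^[k] S) = F^[k] S
    · right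
      rw [Function.iterate_succ_apply', hk, hk]
    · left
      have hlt : F^[k] S ⊂ F^[k + 1] S := by
        refine (h k).ssubset_of_ne fun heq => hk ?_
        rw [Function.iterate_succ_apply'] at heq
        exact heq.symm
      have := Set.ncard_lt_ncard hlt
      have := ih.resolve_right hk
      omega

/-- An increasing iteration on the subsets of a set with `N` elements stops after `N` steps. -/
lemma Set.iterate_isFixed {α : Type*} [Finite α] {F : Set α → Set α} {S : Set α}
    (h : ∀ k, F^[k] S ⊆ F^[k + 1] S) : F (F^[Nat.card α] S) = F^[Nat.card α] S := by
  rcases Set.ncard_le_iterate_or_isFixed h (Nat.card α) with h1 | h1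
  · have h2 : F^[Nat.card α] S = Set.univ :=
      Set.eq_of_subset_of_ncard_le (Set.subset_univ _) (by rwa [Set.ncard_univ])
    have h3 := h (Nat.card α)
    rw [Function.iterate_succ_apply', h2] at h3
    rw [h2, Set.univ_subset_iff.1 h3]
  · exact h1

lemma Set.iterate_eq_of_isLeast {α : Type*} [Finite α] {F : Set α → Set α} (hF : Monotone F)
    {T : Set α} (hT : IsLeast {C | F C ⊆ C} T) : F^[Nat.card α] ∅ = T := by
  have hmono : ∀ k, F^[k] ∅ ⊆ F^[k + 1] ∅ := fun k =>
    (hF.monotone_iterate_of_le_map (Set.empty_subset _)) (Nat.le_succ k)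
  apply Set.Subset.antisymm
  · have : ∀ k, F^[k] ∅ ⊆ T := by
      intro k
      induction k with
      | zero => exact Set.empty_subset _
      | succ k ih =>
        rw [Function.iterate_succ_apply']
        exact (hF ih).trans hT.1
    exact this _
  · exact hT.2 (Set.iterate_isFixed hmono).le

namespace RAM

open Compression

variable {Γ Γ' : Ctx.{u}} {f : ∀ I, Γ.T I → I.V}

/-- One round of the iteration of an operator on sets of signed vertices: `P₀` and `P₁` decide
membership in the new set, which is collected in a second array and then copied. -/
def roundProgram (d m : ℕ) (P₀ P₁ : Program) : Program :=
  .seq (forLoop (d + 1) (.seq (.seq P₀ (.write (m + 1) (.reg (d + 1)) (.const 0) (.reg 1)))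
      (.seq P₁ (.write (m + 1) (.reg (d + 1)) (.const 1) (.reg 1)))))
    (forLoop (d + 1) (.seq
      (.write m (.reg (d + 1)) (.const 0) (.read (m + 1) (.reg (d + 1)) (.const 0)))
      (.write m (.reg (d + 1)) (.const 1) (.read (m + 1) (.reg (d + 1)) (.const 1)))))

/-- A round replaces the set `L` in the array `Γ.m` by `F I γ L`. It leaves register `Γ.d` alone,
which counts the rounds. -/
lemma halts_roundProgram {F : ∀ I, Γ.T I → Set (I.V × Bool) → Set (I.V × Bool)}
    {P₀ P₁ : Program} {p₀ p₁ : Polynomial ℕ}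
    (h₀ : ∀ I γ s, Γ.set.elem.rep I γ s → Halts P₀ s (p₀.eval I.n) fun s' =>
      Agree Γ.set.elem.d Γ.set.elem.m s s' ∧ s'.reg 1 = bit ((γ.2, false) ∈ F I γ.1.1 γ.1.2))
    (h₁ : ∀ I γ s, Γ.set.elem.rep I γ s → Halts P₁ s (p₁.eval I.n) fun s' =>
      Agree Γ.set.elem.d Γ.set.elem.m s s' ∧ s'.reg 1 = bit ((γ.2, true) ∈ F I γ.1.1 γ.1.2))
    {I : Input.{u}} {γ : Γ.T I} {L : Set (I.V × Bool)} {s : Store} (hs : Γ.set.rep I (γ, L) s) :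
    Halts (roundProgram Γ.d Γ.m P₀ P₁) s
      ((I.n * (((p₀.eval I.n + 4) + (p₁.eval I.n + 4)) + 8) + 6) + (I.n * (12 + 8) + 6))
      fun s' => Γ.set.rep I (γ, F I γ L) s' ∧ Agree (Γ.d + 1) Γ.m s s' := by
  have hd := Γ.two_le
  have hrep : ∀ s', Agree (Γ.d + 1) (Γ.m + 1) s s' → Γ.set.rep I (γ, L) s' := fun s' h =>
    ⟨Γ.frame hs.1 (h.mono (by omega) (by omega)), fun v c => by
      rw [h.2 _ (by omega)]; exact hs.2 v c⟩
  refine Halts.seq (Halts.forLoop (x := Γ.d + 1) (n := I.n)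
    (T := (p₀.eval I.n + 4) + (p₁.eval I.n + 4)) (fun i s' => Agree (Γ.d + 1) (Γ.m + 1) s s' ∧
      s'.reg (Γ.d + 1) = i ∧ ∀ v c, (I.e v : ℕ) < i →
        s'.arr (Γ.m + 1) (I.e v) (Bool.toNat c) = bit ((v, c) ∈ F I γ L)) ?_ ?_ ?_)
    fun s₁ h₁' => Halts.imp (Halts.forLoop (x := Γ.d + 1) (n := I.n)
      (T := 12) (fun i s' => Agree (Γ.d + 1) Γ.m s s' ∧ s'.reg (Γ.d + 1) = i ∧
        (∀ v c, s'.arr (Γ.m + 1) (I.e v) (Bool.toNat c) = bit ((v, c) ∈ F I γ L)) ∧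
        ∀ v c, (I.e v : ℕ) < i →
          s'.arr Γ.m (I.e v) (Bool.toNat c) = bit ((v, c) ∈ F I γ L)) ?_ ?_ ?_) le_rfl
      fun s₂ h₂' => ⟨⟨Γ.frame hs.1 (h₂'.1.mono (by omega) le_rfl), fun v c =>
        h₂'.2.2.2 v c (I.e v).2⟩, h₂'.1⟩
  · refine ⟨(Agree.refl _ _ _).setReg (by omega), by simp [Store.setReg], by simp⟩
  · exact fun i s' h => ⟨(Γ.input (hrep s' h.1).1).1, h.2.1⟩
  · rintro i s' hi ⟨ha, hx, hF⟩
    set w := I.e.symm ⟨i, hi⟩ with hw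
    have hwi : (I.e w : ℕ) = i := by simp [hw]
    have hlt : ∀ v, (I.e v : ℕ) < i + 1 → (I.e v : ℕ) ≠ i → (I.e v : ℕ) < i := by omega
    have hin : ∀ v, (I.e v : ℕ) = i → v = w := fun v hv =>
      I.e.injective (Fin.ext (hv.trans hwi.symm))
    have hrep' : ∀ s'', Agree (Γ.d + 1) (Γ.m + 1) s s'' → s''.reg (Γ.d + 1) = i →
        Γ.set.elem.rep I ((γ, L), w) s'' := fun s'' h h' => ⟨hrep s'' h, h'.trans hwi.symm⟩
    have hag : ∀ {a b}, Agree Γ.set.elem.d Γ.set.elem.m a b →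
        Agree (Γ.d + 1) (Γ.m + 1) a b := fun h => h.mono (by simp [Ctx.elem, Ctx.set])
          (by simp [Ctx.elem, Ctx.set])
    refine Halts.seq (R := fun s'' => Agree (Γ.d + 1) (Γ.m + 1) s s'' ∧ s''.reg (Γ.d + 1) = i ∧
      (∀ v c, (I.e v : ℕ) < i →
        s''.arr (Γ.m + 1) (I.e v) (Bool.toNat c) = bit ((v, c) ∈ F I γ L)) ∧
      s''.arr (Γ.m + 1) i 0 = bit ((w, false) ∈ F I γ L)) ?_ ?_
    · refine (h₀ I ((γ, L), w) s' (hrep' s' ha hx)).seq (t' := 4) fun s₁ h₁ => Halts.write ?_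
      have hx₁ : s₁.reg (Γ.d + 1) = i :=
        (h₁.1.1 _ (by simp [Ctx.elem, Ctx.set]) (by omega)).trans hx
      have harr : s₁.arr (Γ.m + 1) = s'.arr (Γ.m + 1) := h₁.1.2 _ (by simp [Ctx.elem, Ctx.set])
      refine ⟨(ha.trans (hag h₁.1)).setArr (by omega), hx₁, fun v c hv => ?_, ?_⟩
      · simp only [Store.setArr, Expr.eval, hx₁]
        rw [if_neg (by omega), harr]
        exact hF v c hv
      · simp only [Store.setArr, Expr.eval, hx₁, h₁.2]
        simp
    · rintro s₂ ⟨ha₂, hx₂, hF₂, hw₂⟩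
      refine (h₁ I ((γ, L), w) s₂ (hrep' s₂ ha₂ hx₂)).seq (t' := 4) fun s₁ h₁ => Halts.write ?_
      have hx₁ : s₁.reg (Γ.d + 1) = i :=
        (h₁.1.1 _ (by simp [Ctx.elem, Ctx.set]) (by omega)).trans hx₂
      have harr : s₁.arr (Γ.m + 1) = s₂.arr (Γ.m + 1) := h₁.1.2 _ (by simp [Ctx.elem, Ctx.set])
      refine ⟨hx₁, ((ha₂.trans (hag h₁.1)).setArr (by omega)).setReg (by omega),
        by simp [Store.setReg], fun v c hv => ?_⟩
      simp only [Store.setArr, Store.setReg, Expr.eval, hx₁, h₁.2, harr, true_and]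
      by_cases hvi : (I.e v : ℕ) = i
      · obtain rfl := hin v hvi
        cases c
        · simpa [hvi] using hw₂
        · simp [hvi]
      · simpa [hvi] using hF₂ v c (hlt v hv hvi)
  · exact ⟨(h₁'.1.mono le_rfl (by omega)).setReg (by omega), by simp [Store.setReg],
      fun v c => h₁'.2.2 v c (I.e v).2, by simp⟩
  · exact fun i s' h => ⟨(Γ.input (Γ.frame hs.1 (h.1.mono (by omega) le_rfl))).1, h.2.1⟩
  · rintro i s' hi ⟨ha, hx, hF, hF'⟩
    have hlt : ∀ v, (I.e v : ℕ) < i + 1 → (I.e v : ℕ) ≠ i → (I.e v : ℕ) < i := by omega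
    refine Halts.seq (t := 6) (t' := 6) (Halts.write (Q := fun s'' => s'' =
      s'.setArr Γ.m i 0 (s'.arr (Γ.m + 1) i 0)) (by simp [Expr.eval, hx])) ?_
    rintro s'' rfl
    refine Halts.write ?_
    have hx' : (s'.setArr Γ.m i 0 (s'.arr (Γ.m + 1) i 0)).reg (Γ.d + 1) = i := hx
    refine ⟨hx', ((ha.setArr le_rfl).setArr le_rfl).setReg (by omega), by simp [Store.setReg],
      fun v c => ?_, fun v c hv => ?_⟩
    · simp only [Store.setArr, Store.setReg]
      simpa using hF v c
    · simp only [Store.setArr, Store.setReg, Expr.eval, hx, true_and]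
      by_cases hvi : (I.e v : ℕ) = i
      · cases c
        · simpa [hvi] using hF v false
        · simpa [hvi] using hF v true
      · simpa [hvi] using hF' v c (hlt v hv hvi)

/-- Iterating a definable operator on sets of signed vertices `2n` times, starting from the empty
set, takes polynomial time. As there are `2n` signed vertices, this suffices for increasing
iterations to become stationary. The machine runs two rounds for each of `n` values of a counter. -/
lemma Comp.iterate {F : ∀ I, Γ.T I → Set (I.V × Bool) → Set (I.V × Bool)}
    (hF : ∀ c, Comp Γ.set.elem fun I γ => (γ.2, c) ∈ F I γ.1.1 γ.1.2) (hf : Var Γ f) (c : Bool) :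
    Comp Γ fun I γ => (f I γ, c) ∈ (F I γ)^[2 * I.n] ∅ := by
  obtain ⟨P₀, p₀, h₀⟩ := hF false
  obtain ⟨P₁, p₁, h₁⟩ := hF true
  obtain ⟨x, hx⟩ := hf
  have hd := Γ.two_le
  set r : Polynomial ℕ := (Polynomial.X * (((p₀ + 4) + (p₁ + 4)) + 8) + 6) +
    (Polynomial.X * (12 + 8) + 6) with hr
  have hround : ∀ {I : Input.{u}} {γ : Γ.T I} {L : Set (I.V × Bool)} {s : Store},
      Γ.set.rep I (γ, L) s → Halts (roundProgram Γ.d Γ.m P₀ P₁) s (r.eval I.n)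
        fun s' => Γ.set.rep I (γ, F I γ L) s' ∧ Agree (Γ.d + 1) Γ.m s s' := fun hs =>
    (halts_roundProgram h₀ h₁ hs).imp (by simp [hr]) fun _ h => h
  refine ⟨.seq (forLoop (Γ.d + 1) (.seq
      (.write Γ.m (.reg (Γ.d + 1)) (.const 0) (.const 0))
      (.write Γ.m (.reg (Γ.d + 1)) (.const 1) (.const 0)))) (.seq
    (forLoop Γ.d (.seq (roundProgram Γ.d Γ.m P₀ P₁) (roundProgram Γ.d Γ.m P₀ P₁)))
    (.assign 1 (.read Γ.m (.reg x) (.const c.toNat)))),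
    (Polynomial.X * (8 + 8) + 6) + ((Polynomial.X * ((r + r) + 8) + 6) + 4), fun I γ s hs => ?_⟩
  refine Halts.imp (Halts.seq (Halts.forLoop (x := Γ.d + 1) (n := I.n) (T := 8)
      (fun i s' => Agree Γ.d Γ.m s s' ∧ s'.reg (Γ.d + 1) = i ∧ ∀ v c, (I.e v : ℕ) < i →
        s'.arr Γ.m (I.e v) (Bool.toNat c) = 0) ?_ ?_ ?_)
    fun s₁ h₁ => Halts.seq (Halts.forLoop (x := Γ.d) (n := I.n) (T := r.eval I.n + r.eval I.n)
      (fun i s' => Agree Γ.d Γ.m s s' ∧ s'.reg Γ.d = i ∧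
        Γ.set.rep I (γ, (F I γ)^[2 * i] ∅) s') ?_ ?_ ?_) (t' := 4)
      fun s₂ h₂ => Halts.assign ⟨h₂.1.setReg (Or.inr rfl), ?_⟩) (by simp) fun _ h => h
  · exact ⟨(Agree.refl _ _ _).setReg (by omega), by simp [Store.setReg], by simp⟩
  · exact fun i s' h => ⟨(Γ.input (Γ.frame hs h.1)).1, h.2.1⟩
  · rintro i s' hi ⟨ha, hi', h0⟩
    have hlt : ∀ v, (I.e v : ℕ) < i + 1 → (I.e v : ℕ) ≠ i → (I.e v : ℕ) < i := by omega
    refine Halts.seq (t := 4) (t' := 4) (Halts.write (Q := fun s'' => s'' =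
      s'.setArr Γ.m i 0 0) (by simp [Expr.eval, hi'])) ?_
    rintro s'' rfl
    refine Halts.write ⟨hi', ((ha.setArr le_rfl).setArr le_rfl).setReg (by omega),
      by simp [Store.setReg], fun v c hv => ?_⟩
    simp only [Store.setArr, Store.setReg, Expr.eval, hi', true_and]
    by_cases hvi : (I.e v : ℕ) = i
    · cases c <;> simp [hvi]
    · simpa [hvi] using h0 v c (hlt v hv hvi)
  · refine ⟨h₁.1.setReg (by omega), by simp [Store.setReg], ?_, fun v c => ?_⟩
    · exact Γ.frame hs (h₁.1.setReg (by omega))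
    · rw [bit_of_not (by simp)]
      exact h₁.2.2 v c (I.e v).2
  · exact fun i s' h => ⟨(Γ.input (Γ.frame hs h.1)).1, h.2.1⟩
  · rintro i s' hi ⟨ha, hi', hrep⟩
    refine (hround hrep).seq fun s₂ h₂ => (hround h₂.1).imp le_rfl fun s₃ h₃ => ?_
    have ha₃ := h₂.2.trans h₃.2
    refine ⟨(ha₃.1 _ (by omega) (by omega)).trans hi',
      (ha.trans (ha₃.mono (by omega) le_rfl)).setReg (by omega), by simp [Store.setReg],
      Γ.frame h₃.1.1 ((Agree.refl _ _ _).setReg (by omega)), ?_⟩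
    rw [show 2 * (i + 1) = 2 * i + 1 + 1 by ring, Function.iterate_succ_apply',
      Function.iterate_succ_apply']
    exact h₃.1.2
  · simp only [Store.setReg, Expr.eval, Function.update_self, hx I γ s₂ h₂.2.2.1]
    exact h₂.2.2.2 _ c

lemma Input.finite (I : Input.{u}) : Finite I.V := Finite.of_equiv _ I.e.symm

lemma Input.card (I : Input.{u}) : Nat.card (I.V × Bool) = 2 * I.n := by
  rw [Nat.card_prod, Nat.card_congr I.e]
  simp [mul_comm]

/-- The least set of signed vertices that is closed under a definable monotone operator. -/
lemma CLit.of_isLeast {T : ∀ I, Γ.T I → Set (I.V × Bool)}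
    {F : ∀ I, Γ.T I → Set (I.V × Bool) → Set (I.V × Bool)}
    (hF : ∀ (Γ' : Ctx.{u}) (π : ∀ I, Γ'.T I → Γ.T I), Ext Γ Γ' π →
      ∀ c, Comp Γ'.set.elem fun I γ => (γ.2, c) ∈ F I (π I γ.1.1) γ.1.2)
    (hmono : ∀ I γ, Monotone (F I γ)) (hT : ∀ I γ, IsLeast {C | F I γ C ⊆ C} (T I γ)) :
    CLit Γ T := by
  intro Γ' π h f hf c
  refine (Comp.iterate (F := fun I γ => F I (π I γ)) (hF Γ' π h) hf c).congr fun I γ => ?_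
  have := I.finite
  rw [← I.card, Set.iterate_eq_of_isLeast (hmono I _) (hT I _)]

/-- The least set of vertices that is closed under a definable monotone operator. -/
lemma CSet.of_isLeast {T : ∀ I, Γ.T I → Set I.V} {F : ∀ I, Γ.T I → Set I.V → Set I.V}
    (hF : ∀ (Γ' : Ctx.{u}) (π : ∀ I, Γ'.T I → Γ.T I), Ext Γ Γ' π → ∀ C, CSet Γ' C →
      Comp Γ'.elem fun I γ => γ.2 ∈ F I (π I γ.1) (C I γ.1))
    (hmono : ∀ I γ, Monotone (F I γ)) (hT : ∀ I γ, IsLeast {C | F I γ C ⊆ C} (T I γ)) :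
    CSet Γ T := by
  have h : CLit Γ fun I γ => {l | l.2 = true ∧ l.1 ∈ T I γ} := by
    refine CLit.of_isLeast
      (F := fun I γ L => {l | l.2 = true ∧ l.1 ∈ F I γ {w | (w, true) ∈ L}}) ?_ ?_ ?_
    · rintro Γ' π h (_ | _)
      -- No vertex has a negative sign; the loop `v ~ v` serves as a property that never holds.
      · exact (Comp.adj (Var.last _) (Var.last _)).congr fun I γ => by simp
      · refine (hF Γ'.set (fun I γ => π I γ.1) (fun I γ s hs => h I _ s hs.1)
          (fun I γ => {w | (w, true) ∈ γ.2}) ?_).congr fun I γ => by simp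
        exact fun Γ'' π' h' f hf => ((CLit.last Γ').ext h').mem hf true
    · exact fun I γ L L' h l hl => ⟨hl.1, hmono I γ (fun w hw => h hw) hl.2⟩
    · refine fun I γ => ⟨?_, fun L hL l hl => ?_⟩
      · refine fun l hl => ⟨hl.1, (hT I γ).1 ?_⟩
        have hs : {w | (w, true) ∈ {l : I.V × Bool | l.2 = true ∧ l.1 ∈ T I γ}} = T I γ := by
          ext w; simp
        rw [← hs]
        exact hl.2
      · have h1 : T I γ ⊆ {w | (w, true) ∈ L} := (hT I γ).2 fun w hw => hL ⟨rfl, hw⟩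
        have h2 := h1 hl.2
        rcases l with ⟨w, c⟩
        obtain rfl : c = true := hl.1
        exact h2
  intro Γ' π hπ f hf
  exact ((h.ext hπ).mem hf true).congr fun I γ => by simp

end RAM

/-! ### Queries about monophonic convexity -/

namespace Monophonic

variable {V : Type u} {G : SimpleGraph V}

/-- One round of the closure rule that generates `Flood`. -/
def floodStep (G : SimpleGraph V) (S D C : Set V) : Set V :=
  {y | y ∈ S ∨ y ∈ D ∧ ∃ x ∈ C, G.Adj x y}

lemma floodStep_mono (S D : Set V) : Monotone (floodStep G S D) := by
  rintro C C' h y (hy | ⟨hy, x, hx, hxy⟩)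
  · exact Or.inl hy
  · exact Or.inr ⟨hy, x, h hx, hxy⟩

lemma isLeast_flood (S D : Set V) :
    IsLeast {C | floodStep G S D C ⊆ C} {x | Flood G S D x} := by
  constructor
  · rintro y (hy | ⟨hy, x, hx, hxy⟩)
    · exact Flood.base hy
    · exact Flood.step hx hxy hy
  · intro C hC x hx
    induction hx with
    | base h => exact hC (Or.inl h)
    | step _ hxy hy ih => exact hC (Or.inr ⟨hy, _, ih, hxy⟩)

/-- A description of imprints by reachability. -/
lemma mem_imprint_iff {A B : Set V} {a : V} : a ∈ imprint G A B ↔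
    a ∈ A ∧ (a ∈ B ∨ ∃ z, Flood G {a} {v | v ∉ A ∧ v ∉ B} z ∧ ∃ b, b ∈ B ∧ b ∉ A ∧ G.Adj z b) := by
  constructor
  · rintro ⟨b, ha, hb, p, hp, h⟩
    refine ⟨ha, ?_⟩
    by_cases haB : a ∈ B
    · exact Or.inl haB
    right
    have hab : a ≠ b := fun h => haB (h ▸ hb)
    have hbA : b ∉ A := fun hbA => hab ((h b p.end_mem_support).1 hbA).symm
    cases hq : p.reverse with
    | nil => exact absurd rfl hab
    | @cons _ z _ hbz q =>
      have hpath := (SimpleGraph.Walk.cons_isPath_iff _ _).1 (hq ▸ hp.reverse)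
      have hqp : ∀ x ∈ q.support, x ∈ p.support := fun x hx => by
        have : x ∈ p.reverse.support := by rw [hq]; simp [hx]
        simpa using this
      refine ⟨z, ?_, b, hb, hbA, hbz.symm⟩
      refine Flood.walk (.base rfl) q.reverse fun x hx => ?_
      have hxq : x ∈ q.support := by simpa using List.mem_of_mem_tail hx
      have hnd := hpath.1.reverse.support_nodup
      rw [← SimpleGraph.Walk.cons_tail_support, List.nodup_cons] at hnd
      refine ⟨fun hxA => ?_, fun hxB => ?_⟩
      · exact hnd.1 ((h x (hqp x hxq)).1 hxA ▸ hx)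
      · exact hpath.2 ((h x (hqp x hxq)).2 hxB ▸ hxq)
  · rintro ⟨ha, haB | ⟨z, hz, b, hb, hbA, hzb⟩⟩
    · exact ⟨a, ha, haB, .nil, .nil, by simp⟩
    · by_cases haB : a ∈ B
      · exact ⟨a, ha, haB, .nil, .nil, by simp⟩
      classical
      obtain ⟨s, rfl, p, hp⟩ := hz.exists_walk
      refine ⟨b, ha, hb, (p.concat hzb).bypass, (p.concat hzb).bypass_isPath, fun x hx => ?_⟩
      have hx' := (p.concat hzb).support_bypass_subset_support hx
      rw [SimpleGraph.Walk.support_concat, List.mem_append, List.mem_singleton] at hx'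
      rcases hx' with hx' | rfl
      · rcases hp x hx' with rfl | h
        · exact ⟨fun _ => rfl, fun h => absurd h haB⟩
        · exact ⟨fun h' => absurd h' h.1, fun h' => absurd h' h.2⟩
      · exact ⟨fun h => absurd h hbA, fun _ => rfl⟩

end Monophonic

namespace RAM

open Compression Monophonic

variable {Γ : Ctx.{u}} {f g f' g' : ∀ I, Γ.T I → I.V} {S D T : ∀ I, Γ.T I → Set I.V}

lemma CSet.flood (hS : CSet Γ S) (hD : CSet Γ D) :
    CSet Γ fun I γ => {x | Flood I.G (S I γ) (D I γ) x} := by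
  refine CSet.of_isLeast (F := fun I γ => floodStep I.G (S I γ) (D I γ)) ?_
    (fun I γ => floodStep_mono _ _) fun I γ => isLeast_flood _ _
  intro Γ' π h C hC
  exact ((hS.ext h).up.mem (Var.last _)).or (((hD.ext h).up.mem (Var.last _)).and
    (Comp.ex ((hC.up.up.mem (Var.last _)).and (Comp.adj (Var.last _) (Var.last _).up))))

lemma CSet.singleton (hf : Var Γ f) : CSet Γ fun I γ => {f I γ} :=
  fun _ _ h _ hg => Comp.eq hg (hf.ext h)

lemma CSet.pair (hf : Var Γ f) (hg : Var Γ g) : CSet Γ fun I γ => {f I γ, g I γ} :=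
  fun _ _ h _ hx => (Comp.eq hx (hf.ext h)).or (Comp.eq hx (hg.ext h))

lemma CSet.hull (hS : CSet Γ S) : CSet Γ fun I γ => hull I.G (S I γ) := by
  refine CSet.of_isLeast (F := fun I γ => hullStep I.G (S I γ)) ?_
    (fun I γ => hullStep_mono _) fun I γ => isLeast_hull _
  intro Γ' π h C hC
  have hC' : CSet Γ'.elem.elem fun I γ =>
      {v | v ∈ C I γ.1.1 ∧ v ≠ γ.2 ∧ ¬ I.G.Adj γ.2 v} := fun Γ'' π' h' x hx =>
    ((hC.up.up.ext h').mem hx).and ((Comp.eq hx ((Var.last _).ext h')).not.and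
      (Comp.adj ((Var.last _).ext h') hx).not)
  have hN : CSet Γ'.elem.elem fun I γ => {v | v ≠ γ.2 ∧ ¬ I.G.Adj γ.2 v} := fun Γ'' π' h' x hx =>
    (Comp.eq hx ((Var.last _).ext h')).not.and (Comp.adj ((Var.last _).ext h') hx).not
  exact ((hS.ext h).up.mem (Var.last _)).or (Comp.ex ((hC.up.up.mem (Var.last _)).and
    ((Comp.adj (Var.last _) (Var.last _).up).and (Comp.ex
      (((hC'.flood hN).up.mem (Var.last _)).and (Comp.adj (Var.last _).up.up (Var.last _)))))))

lemma CSet.imprint (hS : CSet Γ S) (hT : CSet Γ T) :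
    CSet Γ fun I γ => imprint I.G (S I γ) (T I γ) := by
  intro Γ' π h f hf
  have hS' := hS.ext h
  have hT' := hT.ext h
  have hN : CSet Γ' fun I γ => {v | v ∉ S I (π I γ) ∧ v ∉ T I (π I γ)} := fun Γ'' π' h' x hx =>
    ((hS'.ext h').mem hx).not.and ((hT'.ext h').mem hx).not
  refine Comp.congr ?_ fun I γ => mem_imprint_iff.symm
  exact (hS'.mem hf).and ((hT'.mem hf).or (Comp.ex ((((CSet.singleton hf).flood hN).up.mem
    (Var.last _)).and (Comp.ex ((hT'.up.up.mem (Var.last _)).and ((hS'.up.up.mem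
      (Var.last _)).not.and (Comp.adj (Var.last _).up (Var.last _))))))))

lemma Comp.lexLe (hf : Var Γ f) (hg : Var Γ g) (hf' : Var Γ f') (hg' : Var Γ g') :
    Comp Γ fun I γ => toLex (I.e (f I γ), I.e (g I γ)) ≤ toLex (I.e (f' I γ), I.e (g' I γ)) := by
  refine Comp.congr ((Comp.le hf' hf).not.or ((Comp.eq hf hf').and (Comp.le hg hg')))
    fun I γ => ?_
  rw [Prod.Lex.toLex_le_toLex, not_le, I.e.apply_eq_iff_eq]

lemma CSet.firstPairs (hS : CSet Γ S) (hT : CSet Γ T) :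
    CSet Γ fun I γ => firstPairs I.G I.e (S I γ) (T I γ) := by
  intro Γ' π h f hf
  have hS' := hS.ext h
  have hT' := hT.ext h
  have hpair : Comp Γ'.elem.elem.elem fun I γ =>
      IsFirstPair I.G I.e (S I (π I γ.1.1.1)) γ.1.1.2 γ.1.2 γ.2 := by
    refine (hS'.up.up.up.mem (Var.last _).up).and ((hS'.up.up.up.mem (Var.last _)).and
      (((CSet.pair (Var.last _).up (Var.last _)).hull.mem (Var.last _).up.up).and ?_))
    refine Comp.all ((hS'.up.up.up.up.mem (Var.last _)).imp (Comp.all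
      ((hS'.up.up.up.up.up.mem (Var.last _)).imp (Comp.imp ?_ ?_))))
    · exact (CSet.pair (Var.last _).up (Var.last _)).hull.mem (Var.last _).up.up.up.up
    · exact Comp.lexLe (Var.last _).up.up.up (Var.last _).up.up (Var.last _).up (Var.last _)
  exact Comp.ex ((hT'.up.mem (Var.last _)).and (Comp.ex (Comp.ex (hpair.and
    ((Comp.eq hf.up.up.up (Var.last _).up).or (Comp.eq hf.up.up.up (Var.last _)))))))

lemma CSet.keptPoints (hS : CSet Γ S) (hT : CSet Γ T) :
    CSet Γ fun I γ => keptPoints I.G I.e (S I γ) (T I γ) := by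
  intro Γ' π h f hf
  have hS' := hS.ext h
  have hT' := hT.ext h
  have hTe : Comp Γ' fun I γ => ∃ v, v ∈ T I (π I γ) := Comp.ex (hT'.up.mem (Var.last _))
  have hfirst : Comp Γ' fun I γ => f I γ ∈ S I (π I γ) ∧
      ∀ v, v ∈ S I (π I γ) → I.e (f I γ) ≤ I.e v :=
    (hS'.mem hf).and (Comp.all ((hS'.up.mem (Var.last _)).imp (Comp.le hf.up (Var.last _))))
  refine ((hTe.not.and hfirst).or (hTe.and
    ((hS'.firstPairs (hS'.hull.imprint hT'.hull)).mem hf))).congr fun I γ => ?_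
  rcases (T I (π I γ)).eq_empty_or_nonempty with he | hne
  · simp only [Monophonic.keptPoints, he, if_pos]
    simp [firstVertex]
  · have : ∃ v, v ∈ T I (π I γ) := hne
    simp only [Monophonic.keptPoints, hne.ne_empty, if_false, this]
    simp

/-- If the two labels of a sample are decided in polynomial time, then the sample is computed in
polynomial time. -/
lemma exists_outputs {S T : ∀ I, Ctx.base.{u}.T I → Set I.V} (hS : CSet Ctx.base S)
    (hT : CSet Ctx.base T) : ∃ (P : Program) (p : Polynomial ℕ), ∀ (I : Input.{u}) (Y : Sample I.V),
      pos Y = S I ⟨⟩ → neg Y = T I ⟨⟩ → Outputs P I.G I.e I.X Y (p.eval I.n) := by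
  obtain ⟨P₁, p₁, h₁⟩ := hS.up.mem (Var.last _)
  obtain ⟨P₂, p₂, h₂⟩ := hT.up.mem (Var.last _)
  let wr : ℕ → Program := fun c => .write 2 (.reg 2) (.const 0) (.const c)
  refine ⟨forLoop 2 (.seq P₁ (.ite (.reg 1) (wr 1) (.seq P₂ (.ite (.reg 1) (wr 2) (wr 0))))),
    Polynomial.X * ((p₁ + (2 + (4 + (p₂ + (2 + (4 + 4)))))) + 8) + 6, fun I Y hY hY' => ?_⟩
  set s := inputStore I.G I.e I.X with hs
  have hbase : Ctx.base.rep I ⟨⟩ s := ⟨by simp [hs, inputStore], fun _ _ => rfl⟩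
  have key := Halts.forLoop (x := 2) (n := I.n) (s := s)
    (T := p₁.eval I.n + (2 + (4 + (p₂.eval I.n + (2 + (4 + 4))))))
    (P := .seq P₁ (.ite (.reg 1) (wr 1) (.seq P₂ (.ite (.reg 1) (wr 2) (wr 0)))))
    (fun i s' => Agree 2 2 s s' ∧ s'.reg 2 = i ∧
      ∀ v, (I.e v : ℕ) < i → s'.arr 2 (I.e v) 0 = labelCode (Y v)) ?_ ?_ ?_
  · obtain ⟨t, ht, s', hr, -, -, h⟩ := key
    exact ⟨t, by simpa using ht, s', hr, fun v => h v (I.e v).2⟩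
  · exact ⟨(Agree.refl _ _ _).setReg (by omega), by simp [Store.setReg], by simp⟩
  · exact fun i s' h => ⟨(h.1.1 0 (by omega) (by omega)).trans hbase.1, h.2.1⟩
  · rintro i s' hi ⟨ha, hx, hdone⟩
    set w := I.e.symm ⟨i, hi⟩ with hw
    have hwi : (I.e w : ℕ) = i := by simp [hw]
    have hin : ∀ v, (I.e v : ℕ) < i + 1 → (I.e v : ℕ) < i ∨ v = w := fun v hv => by
      rcases Nat.lt_succ_iff_lt_or_eq.1 hv with h | h
      · exact Or.inl h
      · exact Or.inr (I.e.injective (Fin.ext (h.trans hwi.symm)))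
    have hrep : ∀ s'', Agree 2 2 s s'' → s''.reg 2 = i → Ctx.base.elem.rep I (⟨⟩, w) s'' :=
      fun s'' h h' => ⟨⟨(h.1 0 (by omega) (by omega)).trans hbase.1,
        fun a ha => (h.2 a ha).trans (hbase.2 a ha)⟩, h'.trans hwi.symm⟩
    have hwr : ∀ c s'', labelCode (Y w) = c → Agree 4 3 s' s'' →
        Halts (wr c) s'' 4 fun s₁ => s₁.reg 2 = i ∧ (Agree 2 2 s (s₁.setReg 2 (i + 1)) ∧
          (s₁.setReg 2 (i + 1)).reg 2 = i + 1 ∧ ∀ v, (I.e v : ℕ) < i + 1 →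
            (s₁.setReg 2 (i + 1)).arr 2 (I.e v) 0 = labelCode (Y v)) := by
      intro c s'' hc ha'
      have hx'' : s''.reg 2 = i := (ha'.1 2 (by omega) (by omega)).trans hx
      refine Halts.write ⟨hx'', ((ha.trans (ha'.mono (by omega) (by omega))).setArr
        le_rfl).setReg (Or.inl le_rfl), by simp [Store.setReg], fun v hv => ?_⟩
      simp only [Store.setReg, Store.setArr, Expr.eval, hx'', true_and, and_true]
      rcases hin v hv with h | rfl
      · rw [if_neg (by omega), ha'.2 2 (by omega)]
        exact hdone v h
      · rw [if_pos hwi, hc]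
    have hpos : ∀ {v}, v ∈ S I ⟨⟩ ↔ Y v = 1 := fun {v} => by rw [← hY]; rfl
    have hneg : ∀ {v}, v ∈ T I ⟨⟩ ↔ Y v = -1 := fun {v} => by rw [← hY']; rfl
    refine (h₁ I (⟨⟩, w) s' (hrep s' ha hx)).seq fun s₁ hs₁ => Halts.ite (fun hb => ?_)
      fun hb => ?_
    · have hYw : Y w = 1 := by simpa [Expr.eval, hs₁.2, bit_eq_zero, hpos] using hb
      exact hwr 1 s₁ (by simp [hYw, labelCode]) hs₁.1
    · have hYw : Y w ≠ 1 := by simpa [Expr.eval, hs₁.2, bit_eq_zero, hpos] using hb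
      refine (h₂ I (⟨⟩, w) s₁ (hrep s₁ (ha.trans (hs₁.1.mono (by decide) (by decide)))
        ((hs₁.1.1 2 (by decide) (by decide)).trans hx))).seq fun s₂ hs₂ => Halts.ite (fun hb => ?_)
        fun hb => ?_
      · have hYw' : Y w = -1 := by simpa [Expr.eval, hs₂.2, bit_eq_zero, hneg] using hb
        exact hwr 2 s₂ (by simp [hYw', labelCode]) (hs₁.1.trans hs₂.1)
      · have hYw' : Y w ≠ -1 := by simpa [Expr.eval, hs₂.2, bit_eq_zero, hneg] using hb
        refine hwr 0 s₂ ?_ (hs₁.1.trans hs₂.1)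
        rcases hv : Y w with _ | _ | _
        · rfl
        · exact absurd hv hYw'
        · exact absurd hv hYw

end RAM

/-! ### Halfspaces as solutions of a constraint system -/

namespace Monophonic

open Compression

variable {V : Type u} {n : ℕ} {G : SimpleGraph V} {e : V ≃ Fin n}

/-- The signed vertices that agree with the side of `H`: `(v, true)` for `v ∈ H` and `(v, false)`
for `v ∉ H`. -/
def lits (H : Set V) : Set (V × Bool) := {l | l.1 ∈ H ↔ l.2 = true}

lemma mem_lits {H : Set V} {v : V} {c : Bool} : (v, c) ∈ lits H ↔ (v ∈ H ↔ c = true) := Iff.rfl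

lemma not_mem_lits {H : Set V} {v : V} {c : Bool} : (v, !c) ∈ lits H ↔ (v, c) ∉ lits H := by
  rw [mem_lits, mem_lits]
  cases c <;> simp

/-- Two non-adjacent vertices on one side of `H` do not both have a neighbour on the other side. -/
def IsAdmissible (G : SimpleGraph V) (H : Set V) : Prop :=
  ∀ u u' w w', u ≠ u' → ¬ G.Adj u u' → G.Adj u w → G.Adj u' w' →
    ∀ c, ¬ ((u, c) ∈ lits H ∧ (u', c) ∈ lits H ∧ (w, !c) ∈ lits H ∧ (w', !c) ∈ lits H)

lemma IsAdmissible.mem_halfspaces {H : Set V} (h : IsAdmissible G H) : H ∈ halfspaces G := by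
  constructor
  · rw [← compl_compl H]
    refine convex_compl_of_clique fun c c' d d' hd hd' hc hc' hdc hdc' hne => ?_
    by_contra hadj
    have hc₁ : c ∈ H := not_not.1 hc
    have hc₁' : c' ∈ H := not_not.1 hc'
    have hd₁ : d ∉ H := hd
    have hd₁' : d' ∉ H := hd'
    exact h c c' d d' hne hadj hdc.symm hdc'.symm true (by simp [mem_lits, *])
  · refine convex_compl_of_clique fun c c' d d' hd hd' hc hc' hdc hdc' hne => ?_
    by_contra hadj
    exact h c c' d d' hne hadj hdc.symm hdc'.symm false (by simp [mem_lits, *])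

lemma isAdmissible_of_mem_halfspaces (hG : G.Connected) {H : Set V} (hH : H ∈ halfspaces G) :
    IsAdmissible G H := by
  have key : ∀ C : Set V, Convex G C → Convex G Cᶜ → ∀ u u' w w', u ≠ u' → ¬ G.Adj u u' →
      G.Adj u w → G.Adj u' w' → u ∈ C → u' ∈ C → w ∉ C → w' ∉ C → False := by
    intro C hC hC' u u' w w' hne hadj huw huw' hu hu' hw hw'
    obtain ⟨p, hp⟩ := hC'.exists_walk hG hw hw'
    refine hadj (hC.adj_of_walk hu hu' (.cons huw (p.concat huw'.symm)) (fun x hx hxC => ?_) hne)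
    simp only [SimpleGraph.Walk.support_cons, List.mem_cons, SimpleGraph.Walk.support_concat,
      List.mem_append, List.not_mem_nil, or_false] at hx
    rcases hx with rfl | hx | rfl
    · exact Or.inl rfl
    · exact absurd hxC (hp x hx)
    · exact Or.inr rfl
  rintro u u' w w' hne hadj huw huw' (_ | _) ⟨h1, h2, h3, h4⟩
  · simp only [mem_lits, Bool.false_eq_true, iff_false, Bool.not_false, iff_true] at h1 h2 h3 h4
    exact key Hᶜ hH.2 (by rw [compl_compl]; exact hH.1) u u' w w' hne hadj huw huw' h1 h2
      (not_not.2 h3) (not_not.2 h4)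
  · simp only [mem_lits, Bool.false_eq_true, iff_false, Bool.not_true, iff_true] at h1 h2 h3 h4
    exact key H hH.1 hH.2 u u' w w' hne hadj huw huw' h1 h2 h3 h4

/-- One round of unit propagation: from three of the four conditions that are excluded by
`IsAdmissible`, the negation of the fourth is inferred. The set `S` is given. -/
def unitStep (G : SimpleGraph V) (S M : Set (V × Bool)) : Set (V × Bool) :=
  {l | l ∈ S ∨
    (∃ u u' w, u ≠ u' ∧ ¬ G.Adj u u' ∧ G.Adj u w ∧ G.Adj u' l.1 ∧
      (u, l.2) ∈ M ∧ (u', l.2) ∈ M ∧ (w, !l.2) ∈ M) ∨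
    (∃ u w w', u ≠ l.1 ∧ ¬ G.Adj u l.1 ∧ G.Adj u w ∧ G.Adj l.1 w' ∧
      (u, !l.2) ∈ M ∧ (w, l.2) ∈ M ∧ (w', l.2) ∈ M)}

lemma unitStep_mono (S : Set (V × Bool)) : Monotone (unitStep G S) := by
  rintro M M' h l (hl | ⟨u, u', w, h1, h2, h3, h4, h5, h6, h7⟩ |
    ⟨u, w, w', h1, h2, h3, h4, h5, h6, h7⟩)
  · exact Or.inl hl
  · exact Or.inr (Or.inl ⟨u, u', w, h1, h2, h3, h4, h h5, h h6, h h7⟩)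
  · exact Or.inr (Or.inr ⟨u, w, w', h1, h2, h3, h4, h h5, h h6, h h7⟩)

/-- The closure of `S` under unit propagation. -/
def units (G : SimpleGraph V) (S : Set (V × Bool)) : Set (V × Bool) :=
  ⋂₀ {M | unitStep G S M ⊆ M}

lemma isLeast_units (S : Set (V × Bool)) : IsLeast {M | unitStep G S M ⊆ M} (units G S) :=
  ⟨fun _ hl _ hM => hM (unitStep_mono S (Set.sInter_subset_of_mem hM) hl), fun M hM _ hl => hl M hM⟩

lemma subset_units (S : Set (V × Bool)) : S ⊆ units G S :=
  fun _ hl => (isLeast_units S).1 (Or.inl hl)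

/-- A set of signed vertices is closed under unit propagation. -/
def IsUnitClosed (G : SimpleGraph V) (M : Set (V × Bool)) : Prop := unitStep G ∅ M ⊆ M

lemma isUnitClosed_units (S : Set (V × Bool)) : IsUnitClosed G (units G S) := by
  rintro l (hl | hl)
  · exact hl.elim
  · exact (isLeast_units S).1 (Or.inr hl)

lemma units_subset {S M : Set (V × Bool)} (hM : IsUnitClosed G M) (hS : S ⊆ M) : units G S ⊆ M := by
  refine (isLeast_units S).2 ?_
  rintro l (hl | hl)
  · exact hS hl
  · exact hM (Or.inr hl)

lemma units_mono {S S' : Set (V × Bool)} (h : S ⊆ S') : units G S ⊆ units G S' :=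
  units_subset (isUnitClosed_units S') (h.trans (subset_units S'))

lemma IsUnitClosed.mem_left {M : Set (V × Bool)} (hM : IsUnitClosed G M) {u u' w w' : V} {c : Bool}
    (hne : u ≠ u') (hadj : ¬ G.Adj u u') (hw : G.Adj u w) (hw' : G.Adj u' w') (h1 : (u, c) ∈ M)
    (h2 : (u', c) ∈ M) (h3 : (w, !c) ∈ M) : (w', c) ∈ M :=
  hM (Or.inr (Or.inl ⟨u, u', w, hne, hadj, hw, hw', h1, h2, h3⟩))

lemma IsUnitClosed.mem_right {M : Set (V × Bool)} (hM : IsUnitClosed G M) {u u' w w' : V} {c : Bool}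
    (hne : u ≠ u') (hadj : ¬ G.Adj u u') (hw : G.Adj u w) (hw' : G.Adj u' w') (h1 : (u, c) ∈ M)
    (h2 : (w, !c) ∈ M) (h3 : (w', !c) ∈ M) : (u', !c) ∈ M :=
  hM (Or.inr (Or.inr ⟨u, w, w', hne, hadj, hw, hw', by simpa using h1, h2, h3⟩))

lemma IsAdmissible.isUnitClosed_lits {H : Set V} (h : IsAdmissible G H) :
    IsUnitClosed G (lits H) := by
  rintro ⟨v, c⟩ (hl | ⟨u, u', w, h1, h2, h3, h4, h5, h6, h7⟩ |
    ⟨u, w, w', h1, h2, h3, h4, h5, h6, h7⟩)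
  · exact hl.elim
  · by_contra hv
    exact h u u' w v h1 h2 h3 h4 c ⟨h5, h6, h7, not_mem_lits.2 hv⟩
  · by_contra hv
    exact h u v w w' h1 h2 h3 h4 (!c)
      ⟨h5, not_mem_lits.2 hv, by simpa using h6, by simpa using h7⟩

/-- No vertex occurs with both signs. -/
def Consistent (M : Set (V × Bool)) : Prop := ∀ v, ¬ ((v, true) ∈ M ∧ (v, false) ∈ M)

lemma Consistent.not_mem {M : Set (V × Bool)} (h : Consistent M) {v : V} {c : Bool}
    (hv : (v, c) ∈ M) : (v, !c) ∉ M := by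
  cases c
  · exact fun h' => h v ⟨h', hv⟩
  · exact fun h' => h v ⟨hv, h'⟩

lemma consistent_of_subset_lits {M : Set (V × Bool)} {H : Set V} (h : M ⊆ lits H) :
    Consistent M := fun _ hv => not_mem_lits.1 (h hv.2) (h hv.1)

/-- The set `H`, changed according to the signs in `M`. -/
def override (M : Set (V × Bool)) (H : Set V) : Set V :=
  {v | (v, true) ∈ M ∨ (v, false) ∉ M ∧ v ∈ H}

lemma subset_lits_override {M : Set (V × Bool)} (hM : Consistent M) (H : Set V) :
    M ⊆ lits (override M H) := by
  rintro ⟨v, _ | _⟩ hv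
  · have := hM.not_mem hv
    simp_all [mem_lits, override]
  · simp_all [mem_lits, override]

lemma mem_lits_override {M : Set (V × Bool)} {H : Set V} {v : V} {c : Bool}
    (h : (v, c) ∈ lits (override M H)) : (v, c) ∈ M ∨ (v, c) ∈ lits H := by
  cases c
  · simp only [mem_lits, override, Set.mem_ofPred_eq, Bool.false_eq_true, iff_false] at h ⊢
    tauto
  · simp only [mem_lits, override, Set.mem_ofPred_eq, iff_true] at h ⊢
    tauto

/-- Given the signs of the two ends of an edge, unit propagation turns the constraints into
constraints on at most two vertices. Hence a consistent set that is closed under unit propagation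
can be completed without revising the other choices: if there is a solution `H` that extends the
closed set `M`, then every larger consistent closed set `M'` also extends to a solution. -/
lemma IsAdmissible.override {H : Set V} (hH : IsAdmissible G H) {M M' : Set (V × Bool)}
    (hM : IsUnitClosed G M) (hM' : IsUnitClosed G M') (hcons : Consistent M') (hMM' : M ⊆ M')
    (hMH : M ⊆ lits H) {a : Bool → V} (ha : ∀ c, (a c, c) ∈ M) (hadj : ∀ c, G.Adj (a c) (a !c)) :
    IsAdmissible G (override M' H) := by
  have hsub := subset_lits_override hcons H
  set H' := Monophonic.override M' H
  -- A constraint on two vertices that unit propagation respects is satisfied by `H'`.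
  have two : ∀ x cx y cy, ((x, cx) ∈ M' → (y, !cy) ∈ M') → ((y, cy) ∈ M' → (x, !cx) ∈ M') →
      ¬ ((x, cx) ∈ lits H ∧ (y, cy) ∈ lits H) →
      ¬ ((x, cx) ∈ lits H' ∧ (y, cy) ∈ lits H') := by
    rintro x cx y cy h1 h2 h3 ⟨hx, hy⟩
    have hx' : (x, cx) ∉ M' := fun h => not_mem_lits.1 (hsub (h1 h)) hy
    have hy' : (y, cy) ∉ M' := fun h => not_mem_lits.1 (hsub (h2 h)) hx
    exact h3 ⟨(mem_lits_override hx).resolve_left hx', (mem_lits_override hy).resolve_left hy'⟩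
  -- A vertex that sees only the end `a c` of the given edge has sign `c`.
  have near : ∀ x c, G.Adj x (a c) → ¬ G.Adj x (a !c) → x ≠ a !c → (x, c) ∈ M := by
    intro x c h1 h2 h3
    have := hM.mem_right (u := a !c) (u' := x) (w := a c) (w' := a c) (c := !c) h3.symm
      (fun h => h2 h.symm) (hadj c).symm h1 (ha _) (by simpa using ha c) (by simpa using ha c)
    simpa using this
  -- A vertex of sign `c` that does not see `a c` has only neighbours of sign `c`.
  have far : ∀ u c w, u ≠ a c → ¬ G.Adj u (a c) → G.Adj u w →
      ¬ ((u, c) ∈ lits H' ∧ (w, !c) ∈ lits H') := by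
    intro u c w h1 h2 h3
    apply two
    · intro hu
      simpa using hM'.mem_left h1.symm (fun h => h2 h.symm) (hadj c) h3 (hMM' (ha c)) hu
        (hMM' (ha _))
    · intro hw
      exact hM'.mem_right h1.symm (fun h => h2 h.symm) (hadj c) h3 (hMM' (ha c))
        (hMM' (ha _)) hw
    · rintro ⟨h4, h5⟩
      exact hH (a c) u (a !c) w h1.symm (fun h => h2 h.symm) (hadj c) h3 c
        ⟨hMH (ha c), h4, hMH (ha _), h5⟩
  rintro u u' w w' hne hnadj huw huw' c ⟨hu, hu', hw, hw'⟩
  have hua : u ≠ a !c := by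
    rintro rfl
    exact not_mem_lits.1 (hsub (hMM' (ha _))) hu
  have hua' : u' ≠ a !c := by
    rintro rfl
    exact not_mem_lits.1 (hsub (hMM' (ha _))) hu'
  by_cases h1 : u = a c
  · refine far u' c w' (fun h => hne (h1.trans h.symm)) (fun h => hnadj ?_) huw' ⟨hu', hw'⟩
    rw [h1]; exact h.symm
  by_cases h1' : u' = a c
  · refine far u c w h1 (fun h => hnadj ?_) huw ⟨hu, hw⟩
    rw [h1']; exact h
  by_cases h2 : G.Adj u (a c)
  swap
  · exact far u c w h1 h2 huw ⟨hu, hw⟩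
  by_cases h2' : G.Adj u' (a c)
  swap
  · exact far u' c w' h1' h2' huw' ⟨hu', hw'⟩
  have hA := hMM' (ha (!c))
  by_cases h3 : G.Adj u (a !c) <;> by_cases h3' : G.Adj u' (a !c)
  · refine two u c u' c (fun h => hM'.mem_right hne hnadj h3 h3' h hA hA)
      (fun h => hM'.mem_right hne.symm (fun h => hnadj h.symm) h3' h3 h hA hA) ?_ ⟨hu, hu'⟩
    exact fun h => hH u u' _ _ hne hnadj h3 h3' c ⟨h.1, h.2, hMH (ha _), hMH (ha _)⟩
  · have h4 := near u' c h2' h3' hua'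
    refine two u c w' (!c) (fun h => ?_) (fun h => ?_) ?_ ⟨hu, hw'⟩
    · simpa using hM'.mem_left hne hnadj h3 huw' h (hMM' h4) hA
    · exact hM'.mem_right hne.symm (fun h => hnadj h.symm) huw' h3 (hMM' h4) h hA
    · exact fun h => hH u u' _ w' hne hnadj h3 huw' c ⟨h.1, hMH h4, hMH (ha _), h.2⟩
  · have h4 := near u c h2 h3 hua
    refine two u' c w (!c) (fun h => ?_) (fun h => ?_) ?_ ⟨hu', hw⟩
    · simpa using hM'.mem_left hne.symm (fun h => hnadj h.symm) h3' huw h (hMM' h4) hA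
    · exact hM'.mem_right hne hnadj huw h3' (hMM' h4) h hA
    · exact fun h => hH u' u _ w hne.symm (fun h => hnadj h.symm) h3' huw c
        ⟨h.1, hMH h4, hMH (ha _), h.2⟩
  · have h4 := near u c h2 h3 hua
    have h4' := near u' c h2' h3' hua'
    refine two w (!c) w' (!c) (fun h => ?_) (fun h => ?_) ?_ ⟨hw, hw'⟩
    · simpa using hM'.mem_left hne hnadj huw huw' (hMM' h4) (hMM' h4') h
    · simpa using hM'.mem_left hne.symm (fun h => hnadj h.symm) huw' huw (hMM' h4') (hMM' h4) h
    · exact fun h => hH u u' w w' hne hnadj huw huw' c ⟨hMH h4, hMH h4', h.1, h.2⟩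

/-! ### The greedy algorithm -/

/-- `v` is the first vertex that does not occur in `M`. -/
def FirstFree (e : V ≃ Fin n) (M : Set (V × Bool)) (v : V) : Prop :=
  ((v, true) ∉ M ∧ (v, false) ∉ M) ∧ ∀ w, (w, true) ∉ M ∧ (w, false) ∉ M → e v ≤ e w

/-- One round of the greedy algorithm: unit propagation, and then a sign for the first vertex that
is still free, which is positive unless this makes unit propagation inconsistent. -/
def greedyStep (G : SimpleGraph V) (e : V ≃ Fin n) (S L : Set (V × Bool)) : Set (V × Bool) :=
  {l | l ∈ units G (S ∪ L) ∨ FirstFree e (units G (S ∪ L)) l.1 ∧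
    (l.2 = true ↔ Consistent (units G (S ∪ L ∪ {(l.1, true)})))}

/-- The result of the greedy algorithm. -/
def greedy (G : SimpleGraph V) (e : V ≃ Fin n) (S : Set (V × Bool)) : Set (V × Bool) :=
  (greedyStep G e S)^[2 * n] ∅

lemma subset_greedyStep (S L : Set (V × Bool)) : S ∪ L ⊆ greedyStep G e S L :=
  fun _ hl => Or.inl (subset_units _ hl)

/-- The greedy algorithm keeps the invariant that its current set extends to a solution. -/
lemma exists_greedyStep_subset_lits {S L : Set (V × Bool)} {a : Bool → V} (ha : ∀ c, (a c, c) ∈ S)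
    (hadj : ∀ c, G.Adj (a c) (a !c)) {H : Set V} (hH : IsAdmissible G H) (hL : S ∪ L ⊆ lits H) :
    ∃ H', IsAdmissible G H' ∧ greedyStep G e S L ⊆ lits H' := by
  have hM : units G (S ∪ L) ⊆ lits H := units_subset hH.isUnitClosed_lits hL
  by_cases hex : ∃ v, FirstFree e (units G (S ∪ L)) v
  · obtain ⟨v, hv⟩ := hex
    have huniq : ∀ w, FirstFree e (units G (S ∪ L)) w → w = v := fun w hw =>
      e.injective (le_antisymm (hw.2 v hv.1) (hv.2 w hw.1))
    by_cases hc : Consistent (units G (S ∪ L ∪ {(v, true)}))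
    · refine ⟨_, hH.override (isUnitClosed_units _) (isUnitClosed_units _) hc
        (units_mono Set.subset_union_left) hM
        (fun c => subset_units _ (Or.inl (ha c))) hadj, ?_⟩
      refine subset_trans ?_ (subset_lits_override hc H)
      rintro ⟨w, c⟩ (hl | ⟨hw, hl⟩)
      · exact units_mono Set.subset_union_left hl
      · obtain rfl := huniq w hw
        obtain rfl : c = true := hl.2 hc
        exact subset_units _ (Or.inr rfl)
    · refine ⟨H, hH, ?_⟩
      rintro ⟨w, c⟩ (hl | ⟨hw, hl⟩)
      · exact hM hl
      · obtain rfl := huniq w hw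
        obtain rfl : c = false := by
          rw [Bool.eq_false_iff]
          exact fun h => hc (hl.1 h)
        refine (not_mem_lits (c := true)).2 fun hv' => hc (consistent_of_subset_lits (H := H)
          (units_subset hH.isUnitClosed_lits (Set.union_subset hL ?_)))
        exact Set.singleton_subset_iff.2 hv'
  · refine ⟨H, hH, ?_⟩
    rintro ⟨w, c⟩ (hl | ⟨hw, -⟩)
    · exact hM hl
    · exact absurd ⟨w, hw⟩ hex

/-- If there is a solution that extends `S`, then the greedy algorithm finds one. -/
lemma exists_greedy_eq_lits {S : Set (V × Bool)} {a : Bool → V} (ha : ∀ c, (a c, c) ∈ S)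
    (hadj : ∀ c, G.Adj (a c) (a !c)) {H : Set V} (hH : IsAdmissible G H) (hS : S ⊆ lits H) :
    ∃ H', IsAdmissible G H' ∧ S ⊆ lits H' ∧ greedy G e S = lits H' := by
  have : Finite V := Finite.of_equiv _ e.symm
  have hcard : 2 * n = Nat.card (V × Bool) := by
    rw [Nat.card_prod, Nat.card_congr e]
    simp [mul_comm]
  have hinv : ∀ k, ∃ H', IsAdmissible G H' ∧ S ∪ (greedyStep G e S)^[k] ∅ ⊆ lits H' := by
    intro k
    induction k with
    | zero => exact ⟨H, hH, by simpa using hS⟩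
    | succ k ih =>
      obtain ⟨H₁, h1, h2⟩ := ih
      obtain ⟨H₂, h3, h4⟩ := exists_greedyStep_subset_lits (e := e) ha hadj h1 h2
      rw [Function.iterate_succ_apply']
      exact ⟨H₂, h3, Set.union_subset
        ((Set.subset_union_left.trans (subset_greedyStep _ _)).trans h4) h4⟩
  have hfix : greedyStep G e S (greedy G e S) = greedy G e S := by
    rw [greedy, hcard]
    refine Set.iterate_isFixed fun k => ?_
    rw [Function.iterate_succ_apply']
    exact Set.subset_union_right.trans (subset_greedyStep _ _)
  obtain ⟨H', h1, h2⟩ := hinv (2 * n)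
  change S ∪ greedy G e S ⊆ lits H' at h2
  refine ⟨H', h1, Set.subset_union_left.trans h2,
    (Set.subset_union_right.trans h2).antisymm ?_⟩
  have hsub : units G (S ∪ greedy G e S) ⊆ greedy G e S := fun l hl => hfix ▸ Or.inl hl
  -- The final set contains every vertex, as a free vertex would receive a sign.
  have hfree : ∀ v, ¬ ((v, true) ∉ units G (S ∪ greedy G e S) ∧
      (v, false) ∉ units G (S ∪ greedy G e S)) := by
    intro v hv
    obtain ⟨w, hw, hmin⟩ := Set.exists_min_image
      {v | (v, true) ∉ units G (S ∪ greedy G e S) ∧ (v, false) ∉ units G (S ∪ greedy G e S)}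
      e (Set.toFinite _) ⟨v, hv⟩
    have hmem : ∀ c : Bool, (c = true ↔
        Consistent (units G (S ∪ greedy G e S ∪ {(w, true)}))) → (w, c) ∈ greedy G e S :=
      fun c hc => hfix ▸ Or.inr ⟨⟨hw, hmin⟩, hc⟩
    have hsup : greedy G e S ⊆ units G (S ∪ greedy G e S) :=
      Set.subset_union_right.trans (subset_units _)
    by_cases hc : Consistent (units G (S ∪ greedy G e S ∪ {(w, true)}))
    · exact hw.1 (hsup (hmem true (iff_of_true rfl hc)))
    · exact hw.2 (hsup (hmem false (iff_of_false Bool.false_ne_true hc)))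
  rintro ⟨v, c⟩ hv
  by_contra hvc
  have hvc' : (v, !c) ∉ greedy G e S := fun h =>
    not_mem_lits.1 (h2 (Or.inr h)) hv
  refine hfree v ?_
  cases c
  · exact ⟨fun h => hvc' (hsub h), fun h => hvc (hsub h)⟩
  · exact ⟨fun h => hvc (hsub h), fun h => hvc' (hsub h)⟩

/-! ### The reconstructor -/

/-- The signs that are given by the sample `Y` and by an edge from `a ∈ H` to `b ∉ H`. -/
def seeds (Y : Sample V) (a b : V) : Set (V × Bool) :=
  {l | l.2 = true ∧ (l.1 ∈ pos Y ∨ l.1 = a) ∨ l.2 = false ∧ (l.1 ∈ neg Y ∨ l.1 = b)}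

/-- The candidate for a halfspace with boundary edge `(a, b)`. -/
def candidate (G : SimpleGraph V) (e : V ≃ Fin n) (Y : Sample V) (a b : V) : Set V :=
  {v | (v, true) ∈ greedy G e (seeds Y a b)}

/-- The candidate is a halfspace that is consistent with the sample. -/
def IsGood (G : SimpleGraph V) (e : V ≃ Fin n) (Y : Sample V) (a b : V) : Prop :=
  IsAdmissible G (candidate G e Y a b) ∧ (∀ v, v ∈ pos Y → v ∈ candidate G e Y a b) ∧
    ∀ v, v ∈ neg Y → v ∉ candidate G e Y a b

/-- `(a, b)` is the lexicographically first pair for which the candidate is good. -/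
def IsFirstGood (G : SimpleGraph V) (e : V ≃ Fin n) (Y : Sample V) (a b : V) : Prop :=
  IsGood G e Y a b ∧ ∀ a' b', IsGood G e Y a' b' → toLex (e a, e b) ≤ toLex (e a', e b')

/-- The reconstructor: the first good candidate, and a constant hypothesis if a label is missing. -/
def reconstructor (G : SimpleGraph V) (e : V ≃ Fin n) (Y : Sample V) : Set V :=
  {v | (¬ ∃ w, w ∈ neg Y) ∨ (∃ w, w ∈ pos Y) ∧ ∃ a b, IsFirstGood G e Y a b ∧
    v ∈ candidate G e Y a b}

/-- Any edge that crosses a consistent halfspace yields a good candidate. -/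
lemma exists_isGood (hG : G.Connected) {Y : Sample V} {H : Set V} (hH : H ∈ halfspaces G)
    (hpos : pos Y ⊆ H) (hneg : neg Y ⊆ Hᶜ) (hp : (pos Y).Nonempty) (hn : (neg Y).Nonempty) :
    ∃ a b, IsGood G e Y a b := by
  obtain ⟨x, hx⟩ := hp
  obtain ⟨y, hy⟩ := hn
  obtain ⟨p⟩ := hG.preconnected x y
  obtain ⟨a, -, b, -, hab, ha, hb⟩ := exists_adj_of_walk p (hpos hx) (hneg hy)
  obtain ⟨H', h1, h2, h3⟩ := exists_greedy_eq_lits (G := G) (e := e) (S := seeds Y a b)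
    (a := fun c => if c then a else b) (H := H)
    (by rintro (_ | _) <;> simp [seeds]) (by rintro (_ | _) <;> simp [hab, hab.symm])
    (isAdmissible_of_mem_halfspaces hG hH) (by
      rintro ⟨v, c⟩ (⟨hc, hv | hv⟩ | ⟨hc, hv | hv⟩) <;> simp only at hc hv <;> subst hc <;>
        rw [mem_lits]
      · simpa using hpos hv
      · simpa [hv] using ha
      · simpa using hneg hv
      · simpa [hv] using hb)
  have hcand : candidate G e Y a b = H' := by
    ext v
    change (v, true) ∈ greedy G e (seeds Y a b) ↔ _
    rw [h3, mem_lits]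
    simp
  refine ⟨a, b, ?_⟩
  rw [IsGood, hcand]
  refine ⟨h1, fun v hv => ?_, fun v hv => ?_⟩
  · have : (v, true) ∈ lits H' := h2 (Or.inl ⟨rfl, Or.inl hv⟩)
    simpa [mem_lits] using this
  · have : (v, false) ∈ lits H' := h2 (Or.inr ⟨rfl, Or.inl hv⟩)
    simpa [mem_lits] using this

lemma isReconstructor_reconstructor (hG : G.Connected) :
    IsReconstructor G e (reconstructor G e) := by
  rintro _ ⟨X, ⟨H, hH, hX⟩, rfl⟩
  have hX' := below_signVector_iff.1 hX
  have hpos := (pos_subset_of_below (compressor_below (G := G) (e := e) X)).trans hX'.1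
  have hneg := (neg_subset_of_below (compressor_below (G := G) (e := e) X)).trans hX'.2
  generalize compressor G e X = Y at hpos hneg
  -- It suffices to separate the labels, as the imprints lie in their hulls.
  suffices h : reconstructor G e Y ∈ halfspaces G ∧ pos Y ⊆ reconstructor G e Y ∧
      neg Y ⊆ (reconstructor G e Y)ᶜ ∧ ((pos Y).Nonempty → neg Y = ∅ →
        reconstructor G e Y = Set.univ) ∧
      ((neg Y).Nonempty → pos Y = ∅ → reconstructor G e Y = ∅) from
    ⟨h.1, (imprint_subset _ _).trans (hull_subset h.1.1 h.2.1),
      (imprint_subset _ _).trans (hull_subset h.1.2 h.2.2.1), h.2.2.2⟩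
  rcases (neg Y).eq_empty_or_nonempty with hn | hn
  · have h1 : reconstructor G e Y = Set.univ := by
      ext v
      simp [reconstructor, hn]
    rw [h1]
    exact ⟨univ_mem_halfspaces, Set.subset_univ _, by simp [hn], fun _ _ => rfl,
      fun h => absurd hn h.ne_empty⟩
  rcases (pos Y).eq_empty_or_nonempty with hp | hp
  · have h1 : reconstructor G e Y = ∅ := by
      ext v
      have : ∃ w, w ∈ neg Y := hn
      simp [reconstructor, hp, this]
    rw [h1]
    exact ⟨empty_mem_halfspaces, hp.le, by simp, fun h => absurd hp h.ne_empty, fun _ _ => rfl⟩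
  obtain ⟨a, b, hab⟩ := exists_isGood (e := e) hG hH hpos hneg hp hn
  have : Finite V := Finite.of_equiv _ e.symm
  obtain ⟨q, hq, hmin⟩ := Set.exists_min_image {q : V × V | IsGood G e Y q.1 q.2}
    (fun q => toLex (e q.1, e q.2)) (Set.toFinite _) ⟨(a, b), hab⟩
  have hfirst : IsFirstGood G e Y q.1 q.2 := ⟨hq, fun a' b' h => hmin (a', b') h⟩
  have h1 : reconstructor G e Y = candidate G e Y q.1 q.2 := by
    ext v
    constructor
    · rintro (h | ⟨-, a', b', h, hv⟩)
      · exact absurd hn h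
      · have h2 := Prod.ext_iff.1 (toLex.injective
          (le_antisymm (h.2 _ _ hfirst.1) (hfirst.2 _ _ h.1)))
        rwa [← e.injective h2.1, ← e.injective h2.2]
    · exact fun hv => Or.inr ⟨hp, q.1, q.2, hfirst, hv⟩
  rw [h1]
  exact ⟨hq.1.mem_halfspaces, hq.2.1, hq.2.2, fun _ h => absurd h hn.ne_empty,
    fun _ h => absurd h hp.ne_empty⟩

end Monophonic

namespace RAM

open Compression Monophonic

variable {Γ : Ctx.{u}} {f g : ∀ I, Γ.T I → I.V} {S : ∀ I, Γ.T I → Set I.V}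
  {L M : ∀ I, Γ.T I → Set (I.V × Bool)}

lemma CLit.union (hL : CLit Γ L) (hM : CLit Γ M) : CLit Γ fun I γ => L I γ ∪ M I γ :=
  fun _ _ h _ hf c => ((hL.ext h).mem hf c).or ((hM.ext h).mem hf c)

lemma Comp.const (p : Prop) : Comp Γ fun _ _ => p := by
  classical
  exact Comp.of_expr (.const (if p then 1 else 0)) fun I γ s _ => by simp [Expr.eval, bit]

lemma CLit.singleton (hf : Var Γ f) (c : Bool) : CLit Γ fun I γ => {(f I γ, c)} :=
  fun _ _ h _ hg c' => ((Comp.eq hg (hf.ext h)).and (Comp.const (c' = c))).congr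
    fun I γ => by simp

lemma Comp.consistent (hL : CLit Γ L) : Comp Γ fun I γ => Consistent (L I γ) :=
  Comp.all ((hL.up.mem (Var.last _) true).and (hL.up.mem (Var.last _) false)).not

lemma CLit.units (hL : CLit Γ L) : CLit Γ fun I γ => units I.G (L I γ) := by
  refine CLit.of_isLeast (F := fun I γ => unitStep I.G (L I γ)) ?_ (fun I γ => unitStep_mono _)
    fun I γ => isLeast_units _
  intro Γ' π h c
  have hM : CLit Γ'.set.elem fun I γ => γ.1.2 := (CLit.last Γ').up
  have x₁ : Var Γ'.set.elem.elem.elem.elem fun I γ => γ.1.1.1.2 := (Var.last _).up.up.up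
  have x₂ : Var Γ'.set.elem.elem.elem.elem fun I γ => γ.1.1.2 := (Var.last _).up.up
  have x₃ : Var Γ'.set.elem.elem.elem.elem fun I γ => γ.1.2 := (Var.last _).up
  have x₄ : Var Γ'.set.elem.elem.elem.elem fun I γ => γ.2 := Var.last _
  have hM' := hM.up.up.up
  refine ((hL.ext h).upSet.up.mem (Var.last _) c).or (Comp.or (Comp.ex (Comp.ex (Comp.ex ?_)))
    (Comp.ex (Comp.ex (Comp.ex ?_))))
  · exact (Comp.eq x₂ x₃).not.and ((Comp.adj x₂ x₃).not.and ((Comp.adj x₂ x₄).and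
      ((Comp.adj x₃ x₁).and ((hM'.mem x₂ c).and ((hM'.mem x₃ c).and (hM'.mem x₄ !c))))))
  · exact (Comp.eq x₂ x₁).not.and ((Comp.adj x₂ x₁).not.and ((Comp.adj x₂ x₃).and
      ((Comp.adj x₁ x₄).and ((hM'.mem x₂ !c).and ((hM'.mem x₃ c).and (hM'.mem x₄ c))))))

lemma CLit.greedy (hL : CLit Γ L) : CLit Γ fun I γ => greedy I.G I.e (L I γ) := by
  intro Γ' π h f hf c
  refine Comp.iterate (F := fun I γ => greedyStep I.G I.e (L I (π I γ))) (fun c => ?_) hf c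
  have hL' : CLit Γ'.set.elem fun I γ => L I (π I γ.1.1) ∪ γ.1.2 :=
    (hL.ext h).upSet.up.union (CLit.last _).up
  have hU := hL'.units
  have hfree : ∀ {Δ : Ctx.{u}} {M : ∀ I, Δ.T I → Set (I.V × Bool)} {x : ∀ I, Δ.T I → I.V},
      CLit Δ M → Var Δ x → Comp Δ fun I γ => (x I γ, true) ∉ M I γ ∧ (x I γ, false) ∉ M I γ :=
    fun hM hx => (hM.mem hx true).not.and (hM.mem hx false).not
  refine (hU.mem (Var.last _) c).or (Comp.and ((hfree hU (Var.last _)).and (Comp.all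
    ((hfree hU.up (Var.last _)).imp (Comp.le (Var.last _).up (Var.last _))))) ?_)
  exact (Comp.const (c = true)).iff
    (Comp.consistent (hL'.union (CLit.singleton (Var.last _) true)).units)

lemma CLit.seeds (hf : Var Γ f) (hg : Var Γ g) :
    CLit Γ fun I γ => seeds I.X (f I γ) (g I γ) := fun _ _ h _ hx c =>
  ((Comp.const (c = true)).and
    ((((CSet.pos Γ).ext h).mem hx).or (Comp.eq hx (hf.ext h)))).or
  ((Comp.const (c = false)).and
    ((((CSet.neg Γ).ext h).mem hx).or (Comp.eq hx (hg.ext h))))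

lemma CSet.candidate (hf : Var Γ f) (hg : Var Γ g) :
    CSet Γ fun I γ => candidate I.G I.e I.X (f I γ) (g I γ) := fun _ _ h _ hx =>
  ((CLit.seeds hf hg).greedy.ext h).mem hx true

lemma Comp.isAdmissible (hS : CSet Γ S) : Comp Γ fun I γ => IsAdmissible I.G (S I γ) := by
  have hlit : ∀ {x : ∀ I, Γ.elem.elem.elem.elem.T I → I.V} (c : Bool),
      Var Γ.elem.elem.elem.elem x → Comp Γ.elem.elem.elem.elem
        fun I γ => (x I γ, c) ∈ lits (S I γ.1.1.1.1) := fun c hx =>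
    (hS.up.up.up.up.mem hx).iff (Comp.const (c = true))
  have x₁ : Var Γ.elem.elem.elem.elem fun I γ => γ.1.1.1.2 := (Var.last _).up.up.up
  have x₂ : Var Γ.elem.elem.elem.elem fun I γ => γ.1.1.2 := (Var.last _).up.up
  have x₃ : Var Γ.elem.elem.elem.elem fun I γ => γ.1.2 := (Var.last _).up
  have x₄ : Var Γ.elem.elem.elem.elem fun I γ => γ.2 := Var.last _
  have hc : ∀ c : Bool, Comp Γ.elem.elem.elem.elem fun I γ =>
      ¬ ((γ.1.1.1.2, c) ∈ lits (S I γ.1.1.1.1) ∧ (γ.1.1.2, c) ∈ lits (S I γ.1.1.1.1) ∧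
        (γ.1.2, !c) ∈ lits (S I γ.1.1.1.1) ∧ (γ.2, !c) ∈ lits (S I γ.1.1.1.1)) := fun c =>
    ((hlit c x₁).and ((hlit c x₂).and ((hlit (!c) x₃).and (hlit (!c) x₄)))).not
  refine Comp.all (Comp.all (Comp.all (Comp.all ((Comp.eq x₁ x₂).not.imp
    ((Comp.adj x₁ x₂).not.imp ((Comp.adj x₁ x₃).imp ((Comp.adj x₂ x₄).imp ?_)))))))
  exact ((hc false).and (hc true)).congr fun I γ => by rw [Bool.forall_bool]

lemma Comp.isGood (hf : Var Γ f) (hg : Var Γ g) :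
    Comp Γ fun I γ => IsGood I.G I.e I.X (f I γ) (g I γ) := by
  have hC := CSet.candidate hf hg
  exact (Comp.isAdmissible hC).and ((Comp.all (((CSet.pos _).mem (Var.last _)).imp
    (hC.up.mem (Var.last _)))).and (Comp.all (((CSet.neg _).mem (Var.last _)).imp
      (hC.up.mem (Var.last _)).not)))

lemma CSet.reconstructor (Γ : Ctx.{u}) : CSet Γ fun I _ => reconstructor I.G I.e I.X := by
  intro Γ' π h f hf
  have hfirst : Comp Γ'.elem.elem fun I γ => IsFirstGood I.G I.e I.X γ.1.2 γ.2 :=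
    (Comp.isGood (Var.last _).up (Var.last _)).and (Comp.all (Comp.all
      ((Comp.isGood (Var.last _).up (Var.last _)).imp
        (Comp.lexLe (Var.last _).up.up.up (Var.last _).up.up (Var.last _).up (Var.last _)))))
  exact (Comp.ex ((CSet.neg _).mem (Var.last _))).not.or
    ((Comp.ex ((CSet.pos _).mem (Var.last _))).and (Comp.ex (Comp.ex (hfirst.and
      ((CSet.candidate (Var.last _).up (Var.last _)).mem hf.up.up)))))

end RAM

/-! ### The compression scheme -/

theorem mainTheorem7 :
    ∃ (P Q : RAM.Program) (p : Polynomial ℕ),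
      ∀ (n : ℕ) (V : Type u) (G : SimpleGraph V) (e : V ≃ Fin n), G.Connected →
        (∀ β : Compression.Sample V → Set V, Monophonic.IsReconstructor G e β →
          Compression.IsLSCS (Monophonic.halfspaces G) (Monophonic.compressor G e) β
            (4 * G.cliqueNum) ∧
          Compression.IsProper (Monophonic.halfspaces G) (Monophonic.compressor G e) β ∧
          Compression.IsStable (Monophonic.halfspaces G) (Monophonic.compressor G e) β) ∧
        ∃ β : Compression.Sample V → Set V, Monophonic.IsReconstructor G e β ∧
          ∀ X ∈ Compression.realizable (Monophonic.halfspaces G),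
            RAM.Outputs P G e X (Monophonic.compressor G e X) (p.eval n) ∧
            RAM.Outputs Q G e (Monophonic.compressor G e X)
              (Compression.signVector (β (Monophonic.compressor G e X))) (p.eval n) := by
  obtain ⟨P, p, hP⟩ := RAM.exists_outputs.{u}
    ((RAM.CSet.pos _).keptPoints (RAM.CSet.neg _)) ((RAM.CSet.neg _).keptPoints (RAM.CSet.pos _))
  have hQ := RAM.CSet.reconstructor.{u} RAM.Ctx.base
  obtain ⟨Q, q, hQ⟩ := RAM.exists_outputs hQ
    (T := fun I _ => (Monophonic.reconstructor I.G I.e I.X)ᶜ)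
    fun _ _ h _ hf => ((hQ.ext h).mem hf).not
  refine ⟨P, Q, p + q, fun n V G e hG => ⟨fun β hβ => ⟨hβ.isLSCS hG, hβ.isProper,
    Monophonic.isStable_compressor hG β⟩, Monophonic.reconstructor G e,
    Monophonic.isReconstructor_reconstructor hG, fun X _ => ⟨?_, ?_⟩⟩⟩
  · obtain ⟨t, ht, h⟩ := hP ⟨V, n, G, e, X⟩ (Monophonic.compressor G e X)
      (Monophonic.pos_compressor X) (Monophonic.neg_compressor X)
    exact ⟨t, ht.trans (by simp), h⟩
  · obtain ⟨t, ht, h⟩ := hQ ⟨V, n, G, e, Monophonic.compressor G e X⟩ _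
      (Compression.pos_signVector _) (Compression.neg_signVector _)
    exact ⟨t, ht.trans (by simp), h⟩
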